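/- All Riesz spaces are real. For a Riesz space $E$, let $E^\sim$ be its order dual (the Riesz space of order bounded linear functionals on $E$, ordered by $f\le g$ iff $f(x)\le g(x)$ for all $x\ge 0$), let $E^{\sim\sim}=(E^\sim)^\sim$, and let $(E^\sim)_n^\sim\subseteq E^{\sim\sim}$ be the Riesz subspace of order continuous functionals on $E^\sim$. An $m$-linear operator between Riesz spaces is positive if it is nonnegative whenever all its arguments are nonnegative, and regular if it is a difference of two positive $m$-linear operators. A Riesz multimorphism is a regular $m$-linear operator $A$ with $|A(x_1,\dots,x_m)|=A(|x_1|,\dots,|x_m|)$ for all $x_1,\dots,x_m$. Let $A\colon E_1\times\cdots\times E_m\to F$ be a regular $m$-linear operator between Riesz spaces, and let $\rho$ be a permutation of $\{1,\dots,m\}$. For $x''\in E_{\rho(k)}^{\sim\sim}$ and a regular form $B$ in the variables $x_j\in E_j$, $j\notin\{\rho(1),\dots,\rho(k-1)\}$, let $\overline{x''}^{\rho}(B)$ be the regular form in the variables $x_j$, $j\notin\{\rho(1),\dots,\rho(k)\}$, obtained by fixing these variables and applying $x''$ to $B$ regarded as a functional of the remaining variable $x_{\rho(k)}\in E_{\rho(k)}$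 (for $k=m$ the result is a real number). The Arens extension $AR_m^\rho(A)\colon E_1^{\sim\sim}\times\cdots\times E_m^{\sim\sim}\to F^{\sim\sim}$ is the $m$-linear operator $$AR_m^\rho(A)(x_1'',\dots,x_m'')(y')=\big(\overline{x_{\rho(m)}''}^{\rho}\circ\cdots\circ\overline{x_{\rho(1)}''}^{\rho}\big)(y'\circ A),\qquad y'\in F^\sim.$$ **Proposition.** Let $E_1,\dots,E_m$ be Archimedean Riesz spaces, let $F$ be a Riesz space and let $A\colon E_1\times\cdots\times E_m\to F$ be a Riesz multimorphism. Then, for every permutation $\rho$ of $\{1,\dots,m\}$, the restriction of $AR_m^\rho(A)$ to $(E_1^\sim)_n^\sim\times\cdots\times(E_m^\sim)_n^\sim$ is a Riesz multimorphism. -/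

import Mathlib

open Filter Topology

universe u v

set_option linter.unusedSectionVars false
set_option linter.unusedVariables false

namespace RieszArens

/-! Throughout, a (real) Riesz space is a type `E` with
`[AddCommGroup E] [Lattice E] [IsOrderedAddMonoid E] [Module ℝ E] [IsOrderedModule ℝ E]`;
`|x| = x ⊔ -x` is the lattice absolute value. -/

/-- A Riesz space is Archimedean if `n x ≤ y` for all `n`, with `x ≥ 0`, forces `x = 0`.
(Mathlib's class `Archimedean` is a different, much stronger condition.) -/
def IsArchimedean (E : Type u) [AddCommGroup E] [Lattice E] : Prop :=
  ∀ x y : E, 0 ≤ x → (∀ n : ℕ, n • x ≤ y) → x = 0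

section OrderDual

variable (E : Type u) [AddCommGroup E] [Lattice E] [IsOrderedAddMonoid E]
  [Module ℝ E] [IsOrderedModule ℝ E]

/-- The linear functionals that are bounded on order intervals. -/
def orderBounded : Submodule ℝ (E →ₗ[ℝ] ℝ) where
  carrier := {f | ∀ a b : E, ∃ M : ℝ, ∀ x ∈ Set.Icc a b, |f x| ≤ M}
  zero_mem' := fun _ _ => ⟨0, fun _ _ => by simp⟩
  add_mem' := by
    intro f g hf hg a b
    obtain ⟨M, hM⟩ := hf a b
    obtain ⟨N, hN⟩ := hg a b
    exact ⟨M + N, fun x hx => (abs_add_le _ _).trans (add_le_add (hM x hx) (hN x hx))⟩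
  smul_mem' := by
    intro c f hf a b
    obtain ⟨M, hM⟩ := hf a b
    refine ⟨|c| * M, fun x hx => ?_⟩
    rw [LinearMap.smul_apply, smul_eq_mul, abs_mul]
    exact mul_le_mul_of_nonneg_left (hM x hx) (abs_nonneg c)

/-- The order dual `E^∼`: all order bounded linear functionals on `E`. -/
def ODual : Type u := ↥(orderBounded E)

noncomputable instance : AddCommGroup (ODual E) := inferInstanceAs (AddCommGroup ↥(orderBounded E))
noncomputable instance : Module ℝ (ODual E) := inferInstanceAs (Module ℝ ↥(orderBounded E))

variable {E}

/-- The underlying linear functional. -/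
noncomputable def ODual.toLin : ODual E →ₗ[ℝ] (E →ₗ[ℝ] ℝ) := (orderBounded E).subtype

noncomputable instance : CoeFun (ODual E) (fun _ => E → ℝ) := ⟨fun f => ODual.toLin f⟩

@[ext] theorem ODual.ext {f g : ODual E} (h : ∀ x, f x = g x) : f = g :=
  Subtype.ext (LinearMap.ext h)

theorem ODual.map_add (f : ODual E) (x y : E) : f (x + y) = f x + f y := _root_.map_add _ x y
theorem ODual.map_sub (f : ODual E) (x y : E) : f (x - y) = f x - f y := _root_.map_sub _ x y
theorem ODual.map_smul (f : ODual E) (c : ℝ) (x : E) : f (c • x) = c * f x :=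
  _root_.map_smul _ c x
theorem ODual.map_zero (f : ODual E) : f (0 : E) = 0 := _root_.map_zero _
theorem ODual.add_apply (f g : ODual E) (x : E) : (f + g) x = f x + g x := rfl
theorem ODual.sub_apply (f g : ODual E) (x : E) : (f - g) x = f x - g x := rfl
theorem ODual.smul_apply (c : ℝ) (f : ODual E) (x : E) : (c • f) x = c * f x := rfl
theorem ODual.zero_apply (x : E) : (0 : ODual E) x = 0 := rfl

/-- A linear functional dominated by a positive one is order bounded. -/
theorem mem_orderBounded_of_dom (f p : E →ₗ[ℝ] ℝ) (hp : ∀ x, 0 ≤ x → 0 ≤ p x)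
    (h : ∀ x, |f x| ≤ p |x|) : f ∈ orderBounded E := by
  intro a b
  refine ⟨p (|a| + |b|), fun x hx => (h x).trans ?_⟩
  have hx' : |x| ≤ |a| + |b| := by
    refine abs_le'.2 ⟨?_, ?_⟩
    · exact hx.2.trans ((le_abs_self b).trans (le_add_of_nonneg_left (abs_nonneg a)))
    · exact (neg_le_neg hx.1).trans ((neg_le_abs a).trans (le_add_of_nonneg_right (abs_nonneg b)))
  have := hp _ (sub_nonneg.2 hx')
  rw [map_sub] at this
  linarith

theorem mem_orderBounded_of_pos (p : E →ₗ[ℝ] ℝ) (hp : ∀ x, 0 ≤ x → 0 ≤ p x) :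
    p ∈ orderBounded E := by
  refine mem_orderBounded_of_dom p p hp fun x => abs_le'.2 ⟨?_, ?_⟩
  · have := hp _ (sub_nonneg.2 (le_abs_self x))
    rw [map_sub] at this
    linarith
  · have := hp (|x| + x) (by simpa using sub_nonneg.2 (neg_le_abs x))
    rw [map_add] at this
    linarith

/-! ### The Riesz space structure of the order dual -/

/-- The order of `E^∼`: `f ≤ g` if `f x ≤ g x` for all `x ≥ 0`. -/
noncomputable instance : PartialOrder (ODual E) where
  le f g := ∀ x : E, 0 ≤ x → f x ≤ g x
  le_refl _ _ _ := le_rfl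
  le_trans _ _ _ h h' x hx := (h x hx).trans (h' x hx)
  le_antisymm f g h h' := by
    have key : ∀ x : E, 0 ≤ x → f x = g x := fun x hx => le_antisymm (h x hx) (h' x hx)
    ext x
    rw [← posPart_sub_negPart x, ODual.map_sub, ODual.map_sub, key _ (posPart_nonneg x),
      key _ (negPart_nonneg x)]

theorem ODual.le_iff {f g : ODual E} : f ≤ g ↔ ∀ x : E, 0 ≤ x → f x ≤ g x := Iff.rfl

theorem ODual.nonneg_iff {f : ODual E} : 0 ≤ f ↔ ∀ x : E, 0 ≤ x → 0 ≤ f x := Iff.rfl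

theorem ODual.mono {f : ODual E} (hf : 0 ≤ f) {x y : E} (h : x ≤ y) : f x ≤ f y := by
  have := ODual.nonneg_iff.1 hf _ (sub_nonneg.2 h)
  rw [ODual.map_sub] at this
  exact sub_nonneg.1 this

noncomputable instance : IsOrderedAddMonoid (ODual E) where
  add_le_add_left f g h k x hx := by
    rw [ODual.add_apply, ODual.add_apply]
    have := h x hx
    linarith

noncomputable instance : IsOrderedModule ℝ (ODual E) where
  smul_le_smul_of_nonneg_left c hc f g h x hx := by
    simpa only [ODual.smul_apply] using mul_le_mul_of_nonneg_left (h x hx) hc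
  smul_le_smul_of_nonneg_right f hf c d hcd x hx := by
    simpa only [ODual.smul_apply] using mul_le_mul_of_nonneg_right hcd (hf x hx)

/-- A map that is additive and positively homogeneous on the positive cone extends linearly. -/
noncomputable def coneExtend (p : E → ℝ) (hadd : ∀ x y, 0 ≤ x → 0 ≤ y → p (x + y) = p x + p y)
    (hsmul : ∀ (c : ℝ) x, 0 ≤ c → 0 ≤ x → p (c • x) = c * p x) : E →ₗ[ℝ] ℝ :=
  have key : ∀ x a b : E, 0 ≤ a → 0 ≤ b → x = a - b → p x⁺ - p x⁻ = p a - p b := by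
    intro x a b ha hb h
    have h1 : x⁺ + b = a + x⁻ := by
      rw [← sub_eq_sub_iff_add_eq_add, posPart_sub_negPart, h]
    have h2 := congrArg p h1
    rw [hadd _ _ (posPart_nonneg x) hb, hadd _ _ ha (negPart_nonneg x)] at h2
    linarith
  { toFun := fun x => p x⁺ - p x⁻
    map_add' := fun x y => by
      rw [key (x + y) (x⁺ + y⁺) (x⁻ + y⁻) (add_nonneg (posPart_nonneg x) (posPart_nonneg y))
        (add_nonneg (negPart_nonneg x) (negPart_nonneg y))
        (by rw [add_sub_add_comm, posPart_sub_negPart, posPart_sub_negPart]),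
        hadd _ _ (posPart_nonneg x) (posPart_nonneg y),
        hadd _ _ (negPart_nonneg x) (negPart_nonneg y)]
      ring
    map_smul' := fun c x => by
      simp only [RingHom.id_apply, smul_eq_mul]
      rcases le_total 0 c with hc | hc
      · rw [key (c • x) (c • x⁺) (c • x⁻) (smul_nonneg hc (posPart_nonneg x))
          (smul_nonneg hc (negPart_nonneg x)) (by rw [← smul_sub, posPart_sub_negPart]),
          hsmul _ _ hc (posPart_nonneg x), hsmul _ _ hc (negPart_nonneg x)]
        ring
      · have hc' : 0 ≤ -c := neg_nonneg.2 hc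
        rw [key (c • x) ((-c) • x⁻) ((-c) • x⁺) (smul_nonneg hc' (negPart_nonneg x))
          (smul_nonneg hc' (posPart_nonneg x))
          (by rw [← smul_sub, ← neg_sub, smul_neg, neg_smul, neg_neg, posPart_sub_negPart]),
          hsmul _ _ hc' (posPart_nonneg x), hsmul _ _ hc' (negPart_nonneg x)]
        ring }

/-- `sup {f y : 0 ≤ y ≤ x}`. -/
noncomputable def supBelow (f : ODual E) (x : E) : ℝ := sSup ((fun y => f y) '' Set.Icc 0 x)

theorem bddAbove_below (f : ODual E) (x : E) : BddAbove ((fun y => f y) '' Set.Icc 0 x) := by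
  obtain ⟨M, hM⟩ := f.2 0 x
  refine ⟨M, ?_⟩
  rintro _ ⟨y, hy, rfl⟩
  exact (le_abs_self _).trans (hM y hy)

theorem le_supBelow (f : ODual E) {x y : E} (hy : 0 ≤ y) (hyx : y ≤ x) : f y ≤ supBelow f x :=
  le_csSup (bddAbove_below f x) ⟨y, ⟨hy, hyx⟩, rfl⟩

theorem supBelow_le (f : ODual E) {x : E} (hx : 0 ≤ x) {M : ℝ}
    (h : ∀ y, 0 ≤ y → y ≤ x → f y ≤ M) : supBelow f x ≤ M := by
  refine csSup_le ⟨_, 0, ⟨le_rfl, hx⟩, rfl⟩ ?_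
  rintro _ ⟨y, hy, rfl⟩
  exact h y hy.1 hy.2

theorem supBelow_add (f : ODual E) (x y : E) (hx : 0 ≤ x) (hy : 0 ≤ y) :
    supBelow f (x + y) = supBelow f x + supBelow f y := by
  refine le_antisymm (supBelow_le f (add_nonneg hx hy) fun z hz hzxy => ?_) ?_
  · have h1 : z - z ⊓ x ≤ y := by
      rw [sub_le_iff_le_add, add_inf]
      exact le_inf (le_add_of_nonneg_left hy) (by rwa [add_comm])
    have h2 := le_supBelow f (le_inf hz hx) inf_le_right
    have h3 := le_supBelow f (sub_nonneg.2 (inf_le_left : z ⊓ x ≤ z)) h1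
    rw [ODual.map_sub] at h3
    linarith
  · have h : ∀ a, 0 ≤ a → a ≤ x → f a ≤ supBelow f (x + y) - supBelow f y := fun a ha hax => by
      have : supBelow f y ≤ supBelow f (x + y) - f a := supBelow_le f hy fun b hb hby => by
        have := le_supBelow f (add_nonneg ha hb) (add_le_add hax hby)
        rw [ODual.map_add] at this
        linarith
      linarith
    have := supBelow_le f hx h
    linarith

theorem supBelow_smul (f : ODual E) (c : ℝ) (x : E) (hc : 0 ≤ c) (hx : 0 ≤ x) :
    supBelow f (c • x) = c * supBelow f x := by
  have le : ∀ (c : ℝ) (x : E), 0 < c → 0 ≤ x → c * supBelow f x ≤ supBelow f (c • x) := by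
    intro c x hc hx
    rw [← le_div_iff₀' hc]
    refine supBelow_le f hx fun y hy hyx => ?_
    rw [le_div_iff₀' hc, ← ODual.map_smul]
    exact le_supBelow f (smul_nonneg hc.le hy) (smul_le_smul_of_nonneg_left hyx hc.le)
  rcases hc.eq_or_lt with rfl | hc
  · have h0 : supBelow f (0 : E) = 0 := le_antisymm
      (supBelow_le f le_rfl fun y hy hy' => by rw [le_antisymm hy' hy, ODual.map_zero])
      (by simpa only [ODual.map_zero] using le_supBelow f (le_refl (0 : E)) le_rfl)
    rw [zero_smul, zero_mul, h0]
  · refine le_antisymm ?_ (le c x hc hx)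
    have := le c⁻¹ (c • x) (inv_pos.2 hc) (smul_nonneg hc.le hx)
    rwa [smul_smul, inv_mul_cancel₀ hc.ne', one_smul, inv_mul_le_iff₀ hc] at this

/-- The positive part of an order bounded functional, by the Riesz–Kantorovich formula
`f⁺(x) = sup {f y : 0 ≤ y ≤ x}` for `x ≥ 0`. -/
noncomputable def ODual.pos (f : ODual E) : ODual E :=
  ⟨coneExtend (supBelow f) (supBelow_add f) (supBelow_smul f), by
    refine mem_orderBounded_of_pos _ fun x hx => ?_
    change 0 ≤ supBelow f x⁺ - supBelow f x⁻
    have h0 : supBelow f (0 : E) = 0 := by simpa using supBelow_smul f 0 0 le_rfl le_rfl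
    rw [posPart_of_nonneg hx, negPart_of_nonneg hx, h0, sub_zero]
    simpa only [ODual.map_zero] using le_supBelow f (le_refl (0 : E)) hx⟩

theorem ODual.pos_apply (f : ODual E) {x : E} (hx : 0 ≤ x) : f.pos x = supBelow f x := by
  have h0 : supBelow f (0 : E) = 0 := by simpa using supBelow_smul f 0 0 le_rfl le_rfl
  change supBelow f x⁺ - supBelow f x⁻ = _
  rw [posPart_of_nonneg hx, negPart_of_nonneg hx, h0, sub_zero]

theorem ODual.pos_nonneg (f : ODual E) : 0 ≤ f.pos := fun x hx => by
  rw [ODual.pos_apply f hx, ODual.zero_apply]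
  simpa only [ODual.map_zero] using le_supBelow f (le_refl (0 : E)) hx

theorem ODual.le_pos (f : ODual E) : f ≤ f.pos := fun x hx => by
  rw [ODual.pos_apply f hx]
  exact le_supBelow f hx le_rfl

theorem ODual.pos_le {f g : ODual E} (h : f ≤ g) (hg : 0 ≤ g) : f.pos ≤ g := fun x hx => by
  rw [ODual.pos_apply f hx]
  exact supBelow_le f hx fun y hy hyx => (h y hy).trans (ODual.mono hg hyx)

/-- The order dual is a lattice, with `f ⊔ g = (f - g)⁺ + g` and `f ⊓ g = f - (f - g)⁺`. -/
noncomputable instance : Lattice (ODual E) where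
  sup f g := (f - g).pos + g
  inf f g := f - (f - g).pos
  le_sup_left f g := sub_le_iff_le_add.1 (ODual.le_pos (f - g))
  le_sup_right f g := le_add_of_nonneg_left (ODual.pos_nonneg (f - g))
  sup_le f g h hf hg :=
    le_sub_iff_add_le.1 (ODual.pos_le (sub_le_sub_right hf g) (sub_nonneg.2 hg))
  inf_le_left f g := sub_le_self f (ODual.pos_nonneg (f - g))
  inf_le_right f g := sub_le_comm.1 (ODual.le_pos (f - g))
  le_inf f g h hg hh :=
    le_sub_comm.1 (ODual.pos_le (sub_le_sub_left hh g) (sub_nonneg.2 hg))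

theorem ODual.posPart_eq (f : ODual E) : f⁺ = f.pos := by
  change (f - 0).pos + 0 = f.pos
  rw [sub_zero, add_zero]

end OrderDual

/-- The order bidual `E^∼∼`. -/
abbrev OBidual (E : Type u) [AddCommGroup E] [Lattice E] [IsOrderedAddMonoid E]
    [Module ℝ E] [IsOrderedModule ℝ E] : Type u := ODual (ODual E)

section OrderContinuous

variable {E : Type u} [AddCommGroup E] [Lattice E] [IsOrderedAddMonoid E]
  [Module ℝ E] [IsOrderedModule ℝ E]

/-- A net `x` is order convergent to `0` if `|x i| ≤ y i` for some net `y` on the same directed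
index set that decreases to `0`. -/
def OrderTendstoZero {ι : Type u} [Preorder ι] (x : ι → E) : Prop :=
  ∃ y : ι → E, Antitone y ∧ IsGLB (Set.range y) 0 ∧ ∀ i, |x i| ≤ y i

/-- An order bounded functional `f` is order continuous if `f (x i) → 0` for every net `x` that is
order convergent to `0`. -/
def IsOrderContinuous (f : ODual E) : Prop :=
  ∀ (ι : Type u) [Preorder ι] [IsDirectedOrder ι] [Nonempty ι] (x : ι → E),
    OrderTendstoZero x → Tendsto (fun i => f (x i)) atTop (𝓝 0)

/-- The positive part of an order continuous functional is order continuous. -/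
theorem IsOrderContinuous.pos {f : ODual E} (hf : IsOrderContinuous f) :
    IsOrderContinuous f.pos := by
  rintro ι _ _ _ x ⟨y, hanti, hglb, hxy⟩
  have hy : ∀ i, 0 ≤ y i := fun i => hglb.1 ⟨i, rfl⟩
  have hP := ODual.pos_nonneg f
  have main : Tendsto (fun i => f.pos (y i)) atTop (𝓝 0) := by
    rw [Metric.tendsto_nhds]
    intro ε hε
    obtain ⟨i₀⟩ := ‹Nonempty ι›
    obtain ⟨z, hz0, hzy, hz⟩ : ∃ z, 0 ≤ z ∧ z ≤ y i₀ ∧ f.pos (y i₀) - ε / 2 < f z := by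
      by_contra! hcon
      have := supBelow_le f (hy i₀) hcon
      rw [ODual.pos_apply f (hy i₀)] at this
      linarith
    have hconv : Tendsto (fun i => f (z ⊓ y i)) atTop (𝓝 0) := by
      refine hf ι (fun i => z ⊓ y i) ⟨y, hanti, hglb, fun i => ?_⟩
      rw [abs_of_nonneg (le_inf hz0 (hy i))]
      exact inf_le_right
    filter_upwards [Metric.tendsto_nhds.1 hconv (ε / 2) (half_pos hε),
      eventually_ge_atTop i₀] with i h1 hi
    rw [Real.dist_0_eq_abs] at h1
    have h2 : f (z - z ⊓ y i) ≤ f.pos (y i₀ - y i) := by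
      refine (ODual.le_pos f _ (sub_nonneg.2 inf_le_left)).trans (ODual.mono hP ?_)
      rw [sub_le_comm, le_inf_iff]
      constructor
      · rw [sub_le_self_iff]
        exact sub_nonneg.2 (hanti hi)
      · rw [sub_sub_eq_add_sub, sub_le_iff_le_add, add_comm (y i)]
        exact add_le_add_left hzy (y i)
    rw [ODual.map_sub, ODual.map_sub] at h2
    rw [Real.dist_0_eq_abs, abs_of_nonneg (hP _ (hy i))]
    have h3 := (abs_lt.1 h1).2
    linarith
  have hneg : Tendsto (fun i => -f.pos (y i)) atTop (𝓝 0) := by simpa using main.neg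
  refine tendsto_of_tendsto_of_tendsto_of_le_of_le hneg main (fun i => ?_) (fun i => ?_)
  · have := ODual.mono hP (neg_le.1 ((neg_le_abs (x i)).trans (hxy i)))
    rw [← zero_sub, ODual.map_sub, ODual.map_zero, zero_sub] at this
    exact this
  · exact ODual.mono hP ((le_abs_self (x i)).trans (hxy i))

variable (E)

/-- The order continuous functionals, as a subspace of the order dual. -/
def orderContinuous : Submodule ℝ (ODual E) where
  carrier := {f | IsOrderContinuous f}
  zero_mem' := fun _ _ _ _ _ _ => by
    simpa only [ODual.zero_apply] using tendsto_const_nhds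
  add_mem' := fun {f g} hf hg ι _ _ _ x hx => by
    simpa only [ODual.add_apply, add_zero] using (hf ι x hx).add (hg ι x hx)
  smul_mem' := fun c f hf ι _ _ _ x hx => by
    simpa only [ODual.smul_apply, mul_zero] using (hf ι x hx).const_mul c

/-- The order continuous dual `E_n^∼`, with the vector and order structure of the order dual;
it is a Riesz subspace. -/
abbrev OCDual : Type u := ↥(orderContinuous E)

noncomputable instance : Lattice (OCDual E) :=
  Subtype.lattice
    (fun {f g} hf hg => (orderContinuous E).add_mem
      (IsOrderContinuous.pos ((orderContinuous E).sub_mem hf hg)) hg)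
    (fun {f g} hf hg => (orderContinuous E).sub_mem hf
      (IsOrderContinuous.pos ((orderContinuous E).sub_mem hf hg)))

noncomputable instance : IsOrderedModule ℝ (OCDual E) where
  smul_le_smul_of_nonneg_left _ hc _ _ h := smul_le_smul_of_nonneg_left (β := ODual E) h hc
  smul_le_smul_of_nonneg_right _ hf _ _ h := smul_le_smul_of_nonneg_right (β := ODual E) h hf

theorem OCDual.coe_abs (f : OCDual E) : ((|f| : OCDual E) : ODual E) = |(f : ODual E)| := rfl

end OrderContinuous

section Multilinear

variable {n : ℕ} {E : Fin n → Type u} {F : Type v}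
  [∀ i, AddCommGroup (E i)] [∀ i, Lattice (E i)] [∀ i, Module ℝ (E i)]
  [AddCommGroup F] [Lattice F] [Module ℝ F]

/-- A multilinear operator is positive if it is nonnegative on nonnegative arguments. -/
def IsPositive (A : MultilinearMap ℝ E F) : Prop := ∀ x, (∀ i, 0 ≤ x i) → 0 ≤ A x

/-- A multilinear operator is regular if it is a difference of two positive ones. -/
def IsRegular (A : MultilinearMap ℝ E F) : Prop :=
  ∃ P Q : MultilinearMap ℝ E F, IsPositive P ∧ IsPositive Q ∧ A = P - Q

/-- A Riesz multimorphism: a regular multilinear operator `A` with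
`|A (x₁, …, xₙ)| = A (|x₁|, …, |xₙ|)`. -/
structure IsRieszMultimorphism (A : MultilinearMap ℝ E F) : Prop where
  regular : IsRegular A
  abs_apply : ∀ x : ∀ i, E i, |A x| = A (fun i => |x i|)

variable [∀ i, IsOrderedAddMonoid (E i)] [∀ i, IsOrderedModule ℝ (E i)]
  [IsOrderedAddMonoid F] [IsOrderedModule ℝ F]

variable (E F) in
/-- The space `L_r(E₁, …, Eₙ; F)` of regular multilinear operators. -/
def regularOps : Submodule ℝ (MultilinearMap ℝ E F) where
  carrier := {A | IsRegular A}
  zero_mem' := ⟨0, 0, fun _ _ => le_rfl, fun _ _ => le_rfl, by simp⟩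
  add_mem' := by
    rintro _ _ ⟨P, Q, hP, hQ, rfl⟩ ⟨P', Q', hP', hQ', rfl⟩
    exact ⟨P + P', Q + Q', fun x hx => add_nonneg (hP x hx) (hP' x hx),
      fun x hx => add_nonneg (hQ x hx) (hQ' x hx), by abel⟩
  smul_mem' := by
    rintro c _ ⟨P, Q, hP, hQ, rfl⟩
    rcases le_total 0 c with hc | hc
    · exact ⟨c • P, c • Q, fun x hx => smul_nonneg hc (hP x hx),
        fun x hx => smul_nonneg hc (hQ x hx), by rw [smul_sub]⟩
    · have hc' : 0 ≤ -c := neg_nonneg.2 hc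
      exact ⟨(-c) • Q, (-c) • P, fun x hx => smul_nonneg hc' (hQ x hx),
        fun x hx => smul_nonneg hc' (hP x hx), by
          rw [← smul_sub, ← neg_sub P Q, smul_neg, neg_smul, neg_neg]⟩

theorem IsRieszMultimorphism.mem_regular {A : MultilinearMap ℝ E F}
    (h : IsRieszMultimorphism A) : A ∈ regularOps E F := h.regular

theorem IsPositive.mem_regular {A : MultilinearMap ℝ E F} (h : IsPositive A) : A ∈ regularOps E F :=
  ⟨A, 0, h, fun _ _ => le_rfl, by simp⟩

/-- `|P x| ≤ P |x|` for a positive multilinear form `P`. -/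
theorem IsPositive.abs_le {P : MultilinearMap ℝ E ℝ} (hP : IsPositive P) (x : ∀ i, E i) :
    |P x| ≤ P (fun i => |x i|) := by
  have key : ∀ s : Finset (Fin n), ∀ x : ∀ i, E i, (∀ i ∉ s, 0 ≤ x i) →
      |P x| ≤ P (fun i => |x i|) := by
    intro s
    induction s using Finset.induction_on with
    | empty =>
      intro x hx
      have hx' : ∀ i, 0 ≤ x i := fun i => hx i (by simp)
      have : (fun i => |x i|) = x := funext fun i => abs_of_nonneg (hx' i)
      rw [this, abs_of_nonneg (hP x hx')]
    | insert j s hj ih =>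
      intro x hx
      have aux : ∀ a : E j, 0 ≤ a →
          |P (Function.update x j a)| ≤ P (Function.update (fun i => |x i|) j a) := by
        intro a ha
        have h := ih (Function.update x j a) (fun i hi => by
          rcases eq_or_ne i j with rfl | hij
          · simpa using ha
          · simpa [hij] using hx i (by simp [hij, hi]))
        have : (fun i => |Function.update x j a i|) = Function.update (fun i => |x i|) j a := by
          funext i
          rcases eq_or_ne i j with rfl | hij
          · simp [abs_of_nonneg ha]
          · simp [hij]
        rwa [this] at h
      have h1 : P x = P (Function.update x j (x j)⁺) - P (Function.update x j (x j)⁻) := by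
        rw [← MultilinearMap.map_update_sub, posPart_sub_negPart, Function.update_eq_self]
      have h2 : P (fun i => |x i|) = P (Function.update (fun i => |x i|) j (x j)⁺)
          + P (Function.update (fun i => |x i|) j (x j)⁻) := by
        rw [← MultilinearMap.map_update_add, posPart_add_negPart,
          Function.update_eq_self j (fun i => |x i|)]
      rw [h1, h2]
      exact (abs_sub _ _).trans (add_le_add (aux _ (posPart_nonneg _)) (aux _ (negPart_nonneg _)))
  exact key Finset.univ x (fun i hi => absurd (Finset.mem_univ i) hi)

/-- The composition `y ∘ A` of a regular multilinear operator `A` with `y ∈ F^∼` is regular. -/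
theorem comp_mem_regular (y : ODual F) {A : MultilinearMap ℝ E F} (hA : A ∈ regularOps E F) :
    (ODual.toLin y).compMultilinearMap A ∈ regularOps E ℝ := by
  have pos : ∀ z : ODual F, 0 ≤ z → ∀ A : MultilinearMap ℝ E F, A ∈ regularOps E F →
      (ODual.toLin z).compMultilinearMap A ∈ regularOps E ℝ := by
    rintro z hz _ ⟨P, Q, hP, hQ, rfl⟩
    refine ⟨(ODual.toLin z).compMultilinearMap P, (ODual.toLin z).compMultilinearMap Q,
      fun x hx => hz _ (hP x hx), fun x hx => hz _ (hQ x hx), ?_⟩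
    ext x
    exact ODual.map_sub z _ _
  have h1 := (regularOps E ℝ).sub_mem (pos y.pos (ODual.pos_nonneg y) A hA)
    (pos (y.pos - y) (sub_nonneg.2 (ODual.le_pos y)) A hA)
  convert h1 using 1
  ext x
  change y (A x) = y.pos (A x) - (y.pos - y) (A x)
  rw [ODual.sub_apply, sub_sub_cancel]

/-- `(y, A) ↦ y ∘ A`, as a bilinear map `F^∼ × L_r(E₁, …, Eₙ; F) → L_r(E₁, …, Eₙ)`. -/
noncomputable def compDual : ODual F →ₗ[ℝ] regularOps E F →ₗ[ℝ] regularOps E ℝ :=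
  LinearMap.mk₂ ℝ (fun y A => ⟨(ODual.toLin y).compMultilinearMap A.1, comp_mem_regular y A.2⟩)
    (fun _ _ _ => rfl) (fun _ _ _ => rfl)
    (fun y A B => Subtype.ext (MultilinearMap.ext fun x => ODual.map_add y (A.1 x) (B.1 x)))
    (fun c y A => Subtype.ext (MultilinearMap.ext fun x => ODual.map_smul y c (A.1 x)))

/-- Listing the variables in the order `ρ(1), …, ρ(n)`:
`permute ρ A` is the form `x ↦ A (x')` with `x'_{ρ(k)} = x_k`. -/
noncomputable def permute (ρ : Equiv.Perm (Fin n)) :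
    regularOps E ℝ →ₗ[ℝ] regularOps (fun k => E (ρ k)) ℝ :=
  ((MultilinearMap.domDomCongrLinearEquiv' ℝ ℝ E ℝ ρ.symm).toLinearMap ∘ₗ
    (regularOps E ℝ).subtype).codRestrict (regularOps (fun k => E (ρ k)) ℝ) (by
      have pos : ∀ P : MultilinearMap ℝ E ℝ, IsPositive P →
          IsPositive (E := fun k => E (ρ k))
            (MultilinearMap.domDomCongrLinearEquiv' ℝ ℝ E ℝ ρ.symm P) := by
        intro P hP x hx
        refine hP _ fun i => ?_
        obtain ⟨k, rfl⟩ := ρ.surjective i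
        have := Equiv.piCongrLeft'_symm_apply_apply E ρ.symm x k
        have h2 := hx k
        rw [← this] at h2
        exact h2
      rintro ⟨_, P, Q, hP, hQ, rfl⟩
      exact ⟨_, _, pos P hP, pos Q hQ,
        map_sub (MultilinearMap.domDomCongrLinearEquiv' ℝ ℝ E ℝ ρ.symm) P Q⟩)

/-- `permute ρ A (x_{ρ(1)}, …, x_{ρ(n)}) = A (x₁, …, xₙ)`. -/
theorem permute_apply (ρ : Equiv.Perm (Fin n)) (A : regularOps E ℝ) (x : ∀ i, E i) :
    (permute ρ A).1 (fun k => x (ρ k)) = A.1 x :=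
  congrArg A.1 ((Equiv.piCongrLeft' E ρ.symm).symm_apply_apply x)

end Multilinear

section Elimination

variable {n : ℕ} {E : Fin (n + 1) → Type u}
  [∀ i, AddCommGroup (E i)] [∀ i, Lattice (E i)] [∀ i, IsOrderedAddMonoid (E i)]
  [∀ i, Module ℝ (E i)] [∀ i, IsOrderedModule ℝ (E i)]

/-- `(x₁, …, xₙ) ↦ A(•, x₁, …, xₙ)` with values in the linear functionals on `E₀`. -/
def sliceLin (A : MultilinearMap ℝ E ℝ) :
    MultilinearMap ℝ (fun i : Fin n => E i.succ) (E 0 →ₗ[ℝ] ℝ) :=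
  MultilinearMap.mk'
    (fun x =>
      { toFun := fun t => A (Fin.cons t x)
        map_add' := fun s t => A.cons_add x s t
        map_smul' := fun c t => A.cons_smul x c t })
    (fun x i a b => LinearMap.ext fun t => by
      simp only [LinearMap.coe_mk, AddHom.coe_mk, LinearMap.add_apply, Fin.cons_update,
        MultilinearMap.map_update_add])
    (fun x i c a => LinearMap.ext fun t => by
      simp only [LinearMap.coe_mk, AddHom.coe_mk, LinearMap.smul_apply, Fin.cons_update,
        MultilinearMap.map_update_smul])

theorem slice_mem_orderBounded (A : regularOps E ℝ) (x : ∀ i : Fin n, E i.succ) :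
    sliceLin A.1 x ∈ orderBounded (E 0) := by
  obtain ⟨_, P, Q, hP, hQ, rfl⟩ := A
  have pos : ∀ P : MultilinearMap ℝ E ℝ, IsPositive P →
      sliceLin P x ∈ orderBounded (E 0) := by
    intro P hP
    refine mem_orderBounded_of_dom _ (sliceLin P (fun i => |x i|)) ?_ ?_
    · intro t ht
      exact hP (Fin.cons t fun i => |x i|) (Fin.cases ht fun i => abs_nonneg (x i))
    · intro t
      have h := hP.abs_le (Fin.cons t x)
      have h' : (fun i => |(Fin.cons t x : ∀ i, E i) i|) = Fin.cons |t| (fun i => |x i|) := by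
        funext i
        exact Fin.cases rfl (fun _ => rfl) i
      rw [h'] at h
      exact h
  exact (orderBounded (E 0)).sub_mem (pos P hP) (pos Q hQ)

/-- For `A ∈ L_r(E₀, …, Eₙ)`, the operator `(x₁, …, xₙ) ↦ A(•, x₁, …, xₙ)` with values in the order
dual of `E₀`. It is again regular. -/
noncomputable def slice : regularOps E ℝ →ₗ[ℝ] regularOps (fun i : Fin n => E i.succ) (ODual (E 0)) where
  toFun A := ⟨(sliceLin A.1).codRestrict (orderBounded (E 0))
      (slice_mem_orderBounded A), by
    obtain ⟨_, P, Q, hP, hQ, rfl⟩ := A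
    refine ⟨(sliceLin P).codRestrict (orderBounded (E 0))
        (slice_mem_orderBounded ⟨P, hP.mem_regular⟩),
      (sliceLin Q).codRestrict (orderBounded (E 0))
        (slice_mem_orderBounded ⟨Q, hQ.mem_regular⟩), ?_, ?_, rfl⟩
    · exact fun x hx t ht => hP (Fin.cons t x) (Fin.cases ht hx)
    · exact fun x hx t ht => hQ (Fin.cons t x) (Fin.cases ht hx)⟩
  map_add' _ _ := rfl
  map_smul' _ _ := rfl

theorem slice_apply (A : regularOps E ℝ) (x : ∀ i : Fin n, E i.succ) (t : E 0) :
    (slice A).1 x t = A.1 (Fin.cons t x) := rfl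

/-- The operator `L_r(E₀, …, Eₙ) → L_r(E₁, …, Eₙ)` that a bidual element `x''` of `E₀` induces by
eliminating the first variable: `(elim x'' A)(x₁, …, xₙ) = x''(A(•, x₁, …, xₙ))`. -/
noncomputable def elim (x : OBidual (E 0)) :
    regularOps E ℝ →ₗ[ℝ] regularOps (fun i : Fin n => E i.succ) ℝ :=
  compDual x ∘ₗ slice

theorem elim_apply (a : OBidual (E 0)) (A : regularOps E ℝ) (x : ∀ i : Fin n, E i.succ) :
    (elim a A).1 x = a ((slice A).1 x) := rfl

theorem elim_add (x y : OBidual (E 0)) (A : regularOps E ℝ) :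
    elim (x + y) A = elim x A + elim y A := rfl

theorem elim_smul (c : ℝ) (x : OBidual (E 0)) (A : regularOps E ℝ) :
    elim (c • x) A = c • elim x A := rfl

theorem elim_nonneg {a : OBidual (E 0)} (ha : 0 ≤ a) {A : regularOps E ℝ} (hA : IsPositive A.1) :
    IsPositive (elim a A).1 := fun x hx =>
  ha ((slice A).1 x) fun t ht => hA (Fin.cons t x) (Fin.cases ht hx)

end Elimination

/-- Eliminating all variables one after the other, the first one first:
`elimAll (x₁'', …, xₙ'') A = (elim xₙ'' ∘ ⋯ ∘ elim x₁'') A`. -/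
noncomputable def elimAll : ∀ {n : ℕ} {E : Fin n → Type u}
    [∀ i, AddCommGroup (E i)] [∀ i, Lattice (E i)] [∀ i, IsOrderedAddMonoid (E i)]
    [∀ i, Module ℝ (E i)] [∀ i, IsOrderedModule ℝ (E i)],
    (∀ i, OBidual (E i)) → regularOps E ℝ →ₗ[ℝ] ℝ
  | 0, _, _, _, _, _, _, _ =>
    { toFun := fun A => A.1 (fun i => i.elim0)
      map_add' := fun _ _ => rfl
      map_smul' := fun _ _ => rfl }
  | _ + 1, _, _, _, _, _, _, x => elimAll (fun i => x i.succ) ∘ₗ elim (x 0)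

section Arens

variable {n : ℕ} {E : Fin n → Type u}
  [∀ i, AddCommGroup (E i)] [∀ i, Lattice (E i)] [∀ i, IsOrderedAddMonoid (E i)]
  [∀ i, Module ℝ (E i)] [∀ i, IsOrderedModule ℝ (E i)]

theorem elimAll_update_add : ∀ {n : ℕ} {E : Fin n → Type u}
    [∀ i, AddCommGroup (E i)] [∀ i, Lattice (E i)] [∀ i, IsOrderedAddMonoid (E i)]
    [∀ i, Module ℝ (E i)] [∀ i, IsOrderedModule ℝ (E i)]
    (x : ∀ i, OBidual (E i)) (i : Fin n) (a b : OBidual (E i)) (A : regularOps E ℝ),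
    elimAll (Function.update x i (a + b)) A =
      elimAll (Function.update x i a) A + elimAll (Function.update x i b) A
  | 0, _, _, _, _, _, _, _, i, _, _, _ => i.elim0
  | n + 1, E, _, _, _, _, _, x, i, a, b, A => by
    induction i using Fin.cases with
    | zero =>
      have h : ∀ c : OBidual (E 0),
          (fun j : Fin n => Function.update x 0 c j.succ) = fun j : Fin n => x j.succ := fun c => by
        funext j
        simp
      simp only [elimAll, LinearMap.comp_apply, h, Function.update_self, elim_add, map_add]
    | succ i =>
      have h : ∀ c : OBidual (E i.succ), (fun j : Fin n => Function.update x i.succ c j.succ) =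
          Function.update (fun j : Fin n => x j.succ) i c := fun c => by
        funext j
        exact congrFun (Function.update_comp_eq_of_injective' x (Fin.succ_injective n) i c) j
      have h0 : ∀ c : OBidual (E i.succ), Function.update x i.succ c 0 = x 0 := fun c =>
        Function.update_of_ne (Fin.succ_ne_zero i).symm _ _
      simp only [elimAll, LinearMap.comp_apply, h, h0]
      exact elimAll_update_add _ _ _ _ _

theorem elimAll_update_smul : ∀ {n : ℕ} {E : Fin n → Type u}
    [∀ i, AddCommGroup (E i)] [∀ i, Lattice (E i)] [∀ i, IsOrderedAddMonoid (E i)]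
    [∀ i, Module ℝ (E i)] [∀ i, IsOrderedModule ℝ (E i)]
    (x : ∀ i, OBidual (E i)) (i : Fin n) (c : ℝ) (a : OBidual (E i)) (A : regularOps E ℝ),
    elimAll (Function.update x i (c • a)) A = c * elimAll (Function.update x i a) A
  | 0, _, _, _, _, _, _, _, i, _, _, _ => i.elim0
  | n + 1, E, _, _, _, _, _, x, i, r, a, A => by
    induction i using Fin.cases with
    | zero =>
      have h : ∀ c : OBidual (E 0),
          (fun j : Fin n => Function.update x 0 c j.succ) = fun j : Fin n => x j.succ := fun c => by
        funext j
        simp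
      simp only [elimAll, LinearMap.comp_apply, h, Function.update_self, elim_smul, map_smul,
        smul_eq_mul]
    | succ i =>
      have h : ∀ c : OBidual (E i.succ), (fun j : Fin n => Function.update x i.succ c j.succ) =
          Function.update (fun j : Fin n => x j.succ) i c := fun c => by
        funext j
        exact congrFun (Function.update_comp_eq_of_injective' x (Fin.succ_injective n) i c) j
      have h0 : ∀ c : OBidual (E i.succ), Function.update x i.succ c 0 = x 0 := fun c =>
        Function.update_of_ne (Fin.succ_ne_zero i).symm _ _
      simp only [elimAll, LinearMap.comp_apply, h, h0]
      exact elimAll_update_smul _ _ _ _ _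

/-- `elimAll x` is a difference of two positive functionals on the regular forms. -/
theorem elimAll_regular : ∀ {n : ℕ} {E : Fin n → Type u}
    [∀ i, AddCommGroup (E i)] [∀ i, Lattice (E i)] [∀ i, IsOrderedAddMonoid (E i)]
    [∀ i, Module ℝ (E i)] [∀ i, IsOrderedModule ℝ (E i)] (x : ∀ i, OBidual (E i)),
    ∃ S T : regularOps E ℝ →ₗ[ℝ] ℝ, (∀ A, IsPositive A.1 → 0 ≤ S A) ∧
      (∀ A, IsPositive A.1 → 0 ≤ T A) ∧ elimAll x = S - T
  | 0, _, _, _, _, _, _, x =>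
    ⟨elimAll x, 0, fun A hA => hA _ fun i => i.elim0, fun _ _ => le_rfl, by simp⟩
  | n + 1, E, _, _, _, _, _, x => by
    obtain ⟨S, T, hS, hT, h⟩ := elimAll_regular (fun i : Fin n => x i.succ)
    have hp := ODual.pos_nonneg (x 0)
    have hq : 0 ≤ (x 0).pos - x 0 := sub_nonneg.2 (ODual.le_pos (x 0))
    refine ⟨S ∘ₗ elim (x 0).pos + T ∘ₗ elim ((x 0).pos - x 0),
      S ∘ₗ elim ((x 0).pos - x 0) + T ∘ₗ elim (x 0).pos,
      fun A hA => add_nonneg (hS _ (elim_nonneg hp hA)) (hT _ (elim_nonneg hq hA)),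
      fun A hA => add_nonneg (hS _ (elim_nonneg hq hA)) (hT _ (elim_nonneg hp hA)), ?_⟩
    ext A
    have e : elim (x 0).pos A = elim (x 0) A + elim ((x 0).pos - x 0) A := by
      rw [← elim_add, add_sub_cancel]
    simp only [elimAll, h, LinearMap.comp_apply, LinearMap.sub_apply, LinearMap.add_apply, e,
      map_add]
    ring

variable {F : Type v} [AddCommGroup F] [Lattice F] [IsOrderedAddMonoid F]
  [Module ℝ F] [IsOrderedModule ℝ F]

/-- The functional `y' ↦ (elim x''_{ρ(n)} ∘ ⋯ ∘ elim x''_{ρ(1)})(y' ∘ A)` on `F^∼`; the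
`k`-th factor of the composition eliminates the variable number `ρ(k)` of the form `y' ∘ A`. -/
noncomputable def arensFun (ρ : Equiv.Perm (Fin n)) (A : regularOps E F) (x : ∀ i, OBidual (E i)) :
    ODual F →ₗ[ℝ] ℝ :=
  elimAll (fun k => x (ρ k)) ∘ₗ permute ρ ∘ₗ compDual.flip A

theorem arensFun_mem (ρ : Equiv.Perm (Fin n)) (A : regularOps E F) (x : ∀ i, OBidual (E i)) :
    arensFun ρ A x ∈ orderBounded (ODual F) := by
  have perm_pos : ∀ B : regularOps E ℝ, IsPositive B.1 → IsPositive (permute ρ B).1 := by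
    intro B hB z hz
    obtain ⟨w, rfl⟩ : ∃ w : ∀ i, E i, (fun k => w (ρ k)) = z :=
      ⟨(Equiv.piCongrLeft' E ρ.symm).symm z, (Equiv.piCongrLeft' E ρ.symm).apply_symm_apply z⟩
    rw [permute_apply]
    exact hB w fun i => by
      obtain ⟨k, rfl⟩ := ρ.surjective i
      exact hz k
  obtain ⟨P, Q, hP, hQ, hA⟩ := A.2
  have hA' : (⟨P, hP.mem_regular⟩ : regularOps E F) = A + ⟨Q, hQ.mem_regular⟩ :=
    Subtype.ext (sub_eq_iff_eq_add.1 hA.symm)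
  obtain ⟨S, T, hS, hT, h⟩ := elimAll_regular (fun k => x (ρ k))
  have mem : ∀ (S : regularOps (fun k => E (ρ k)) ℝ →ₗ[ℝ] ℝ), (∀ A, IsPositive A.1 → 0 ≤ S A) →
      ∀ (P : MultilinearMap ℝ E F) (hP : IsPositive P),
      S ∘ₗ permute ρ ∘ₗ compDual.flip ⟨P, hP.mem_regular⟩ ∈ orderBounded (ODual F) :=
    fun S hS P hP => mem_orderBounded_of_pos _ fun y hy =>
      hS _ (perm_pos _ fun z hz => hy _ (hP z hz))
  have key := Submodule.sub_mem _ (Submodule.sub_mem _ (mem S hS P hP) (mem T hT P hP))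
    (Submodule.sub_mem _ (mem S hS Q hQ) (mem T hT Q hQ))
  convert key using 1
  rw [hA', arensFun, h]
  ext y
  simp only [LinearMap.comp_apply, LinearMap.sub_apply, LinearMap.add_apply, map_add]
  ring

/-- The Arens extension `AR_n^ρ(A) : E₁^∼∼ × ⋯ × Eₙ^∼∼ → F^∼∼` of a regular multilinear operator
`A : E₁ × ⋯ × Eₙ → F`, for a permutation `ρ`. -/
noncomputable def arens (ρ : Equiv.Perm (Fin n)) (A : regularOps E F) :
    MultilinearMap ℝ (fun i => OBidual (E i)) (OBidual F) :=
  MultilinearMap.mk' (fun x => ⟨arensFun ρ A x, arensFun_mem ρ A x⟩)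
    (fun x i a b => by
      obtain ⟨k, rfl⟩ := ρ.surjective i
      have h : ∀ c, (fun j => Function.update x (ρ k) c (ρ j)) =
          Function.update (fun j => x (ρ j)) k c := fun c =>
        Function.update_comp_eq_of_injective' x ρ.injective k c
      refine ODual.ext fun y => ?_
      change elimAll _ _ = elimAll _ _ + elimAll _ _
      simp only [h]
      exact elimAll_update_add _ _ _ _ _)
    (fun x i c a => by
      obtain ⟨k, rfl⟩ := ρ.surjective i
      have h : ∀ c, (fun j => Function.update x (ρ k) c (ρ j)) =
          Function.update (fun j => x (ρ j)) k c := fun c =>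
        Function.update_comp_eq_of_injective' x ρ.injective k c
      refine ODual.ext fun y => ?_
      change elimAll _ _ = c * elimAll _ _
      simp only [h]
      exact elimAll_update_smul _ _ _ _ _)

end Arens

end RieszArens

/-! A positive multilinear operator commutes with absolute values once it preserves disjointness in
each variable (`IsPositive.abs_apply_of_disjoint`). So fix positive order continuous `x i`, disjoint
`u` and `v` in the `j`-th variable and `y ≥ 0`, and bound the infimum of the two extensions at `y`.

Order continuity brings the problem back to points of the spaces. A positive order continuous `φ` on
the order dual is the limit of its truncations `φ ⊓ evalBidual a` as `a` increases through the
positive cone (`tendsto_sub_inf_evalBidual`). Truncating every variable therefore changes the value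
of the extension at `y` by little (`exists_elimAll_inf_evalBidual`), and the truncated functionals
are dominated by evaluations at a common point `b`.

With evaluations at `b` in all variables but the `j`-th, the extension is the biadjoint of `T = A(b,
…, ·, …, b)`, whatever the order of elimination (`arens_update_evalBidual`). As `b ≥ 0`, `T` is a
Riesz homomorphism, so by Hahn–Banach its adjoint is interval preserving (`exists_comp_eq_of_le`).
Hence a splitting of `y ∘ T` that witnesses `u ⊓ v = 0` lifts to a splitting of `y`, which makes the
infimum small (`arens_update_inf_eq_zero`). -/

namespace RieszArens

/-! ### Evaluations and order continuous functionals on the order dual -/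

section Functionals

variable {E : Type u} [AddCommGroup E] [Lattice E] [IsOrderedAddMonoid E]
  [Module ℝ E] [IsOrderedModule ℝ E]

/-- With the next lemma, this is the Riesz–Kantorovich formula: the infimum at `x` is the infimum of
`f (x - y) + g y` over `y` in `[0, x]`. -/
theorem ODual.inf_apply_le (f g : ODual E) {x y : E} (hy : 0 ≤ y) (hyx : y ≤ x) :
    (f ⊓ g) x ≤ f (x - y) + g y := by
  have h := le_supBelow (f - g) hy hyx
  rw [ODual.sub_apply] at h
  change (f - (f - g).pos) x ≤ _
  rw [ODual.sub_apply, ODual.pos_apply _ (hy.trans hyx), ODual.map_sub]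
  linarith

theorem ODual.exists_lt_inf_apply_add (f g : ODual E) {x : E} (hx : 0 ≤ x) {ε : ℝ} (hε : 0 < ε) :
    ∃ y, 0 ≤ y ∧ y ≤ x ∧ f (x - y) + g y < (f ⊓ g) x + ε := by
  by_contra! hcon
  have h : supBelow (f - g) x ≤ supBelow (f - g) x - ε := supBelow_le _ hx fun y hy hyx => by
    have h := hcon y hy hyx
    change (f - (f - g).pos) x + ε ≤ _ at h
    rw [ODual.sub_apply, ODual.pos_apply _ hx, ODual.map_sub] at h
    rw [ODual.sub_apply]
    linarith
  linarith

/-- Evaluation at a point, as an element of the order bidual. -/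
noncomputable def evalBidual (a : E) : OBidual E :=
  ⟨{ toFun := fun f => f a
     map_add' := fun _ _ => rfl
     map_smul' := fun _ _ => rfl }, by
    have h : ∀ b : E, 0 ≤ b → ({ toFun := fun f => f b
                                 map_add' := fun _ _ => rfl
                                 map_smul' := fun _ _ => rfl } : ODual E →ₗ[ℝ] ℝ) ∈
        orderBounded (ODual E) :=
      fun b hb => mem_orderBounded_of_pos _ fun f hf => hf b hb
    convert (orderBounded (ODual E)).sub_mem (h _ (posPart_nonneg a)) (h _ (negPart_nonneg a))
    refine LinearMap.ext fun f => ?_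
    change f a = f a⁺ - f a⁻
    rw [← ODual.map_sub, posPart_sub_negPart]⟩

theorem evalBidual_apply (a : E) (f : ODual E) : evalBidual a f = f a := rfl

theorem evalBidual_mono {a b : E} (h : a ≤ b) : evalBidual a ≤ evalBidual b :=
  fun _ hf => ODual.mono hf h

theorem evalBidual_nonneg {a : E} (h : 0 ≤ a) : 0 ≤ evalBidual a := fun _ hf => hf a h

theorem evalBidual_add (a b : E) : evalBidual (a + b) = evalBidual a + evalBidual b :=
  ODual.ext fun f => ODual.map_add f a b

/-- An antitone net of positive functionals converges pointwise to a positive functional. -/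
theorem ODual.exists_tendsto_of_antitone {ι : Type*} [Preorder ι] [IsDirectedOrder ι] [Nonempty ι]
    (f : ι → ODual E) (hf : Antitone f) (h0 : ∀ i, 0 ≤ f i) :
    ∃ g : ODual E, 0 ≤ g ∧ (∀ i, g ≤ f i) ∧ ∀ x, Tendsto (fun i => f i x) atTop (𝓝 (g x)) := by
  have hpos : ∀ x, 0 ≤ x → ∃ l, Tendsto (fun i => f i x) atTop (𝓝 l) := fun x hx =>
    ⟨_, tendsto_atTop_ciInf (fun i j hij => hf hij x hx)
      ⟨0, by rintro _ ⟨i, rfl⟩; exact h0 i x hx⟩⟩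
  have hall : ∀ x, ∃ l, Tendsto (fun i => f i x) atTop (𝓝 l) := fun x => by
    obtain ⟨l, hl⟩ := hpos _ (posPart_nonneg x)
    obtain ⟨k, hk⟩ := hpos _ (negPart_nonneg x)
    refine ⟨l - k, (hl.sub hk).congr fun i => ?_⟩
    rw [← ODual.map_sub, posPart_sub_negPart]
  choose L hL using hall
  let G : E →ₗ[ℝ] ℝ :=
    { toFun := L
      map_add' := fun x y => tendsto_nhds_unique (hL (x + y))
        (((hL x).add (hL y)).congr fun i => (ODual.map_add _ x y).symm)
      map_smul' := fun c x => tendsto_nhds_unique (hL (c • x))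
        (((hL x).const_mul c).congr fun i => (ODual.map_smul _ c x).symm) }
  have hG : ∀ x, 0 ≤ x → 0 ≤ G x := fun x hx =>
    ge_of_tendsto' (hL x) fun i => h0 i x hx
  refine ⟨⟨G, mem_orderBounded_of_pos G hG⟩, hG, fun i x hx => ?_, hL⟩
  refine le_of_tendsto (hL x) ?_
  filter_upwards [eventually_ge_atTop i] with j hj using hf hj x hx

/-- The dual order is pointwise on the positive cone, so a pointwise limit zero forces every lower
bound to be nonpositive. -/
theorem isGLB_zero_of_tendsto {ι : Type*} [Preorder ι] [IsDirectedOrder ι] [Nonempty ι]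
    {f : ι → ODual E} (h0 : ∀ i, 0 ≤ f i)
    (h : ∀ x, 0 ≤ x → Tendsto (fun i => f i x) atTop (𝓝 0)) : IsGLB (Set.range f) 0 := by
  refine ⟨by rintro _ ⟨i, rfl⟩; exact h0 i, fun b hb x hx => ?_⟩
  exact ge_of_tendsto' (h x hx) fun i => hb ⟨i, rfl⟩ x hx

/-- An order continuous functional vanishes along an antitone net with infimum zero. -/
theorem IsOrderContinuous.tendsto_of_antitone {φ : ODual E} (hφ : IsOrderContinuous φ)
    {ι : Type u} [Preorder ι] [IsDirectedOrder ι] [Nonempty ι] {y : ι → E} (hy : Antitone y)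
    (hglb : IsGLB (Set.range y) 0) : Tendsto (fun i => φ (y i)) atTop (𝓝 0) :=
  hφ ι y ⟨y, hy, hglb, fun i => (abs_of_nonneg (hglb.1 ⟨i, rfl⟩)).le⟩

/-- If `y` dominates the net `x`, then `|ψ (x i)| ≤ ψ (y i) ≤ φ (y i)`, and the last term tends to
zero. -/
theorem IsOrderContinuous.of_le {φ ψ : ODual E} (hφ : IsOrderContinuous φ) (h0 : 0 ≤ ψ)
    (h : ψ ≤ φ) : IsOrderContinuous ψ := by
  rintro ι _ _ _ x ⟨y, hanti, hglb, hxy⟩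
  have hlim := hφ.tendsto_of_antitone hanti hglb
  have hb : ∀ i, |ψ (x i)| ≤ φ (y i) := fun i => by
    have h1 := ODual.mono h0 ((le_abs_self (x i)).trans (hxy i))
    have h2 := ODual.mono h0 ((neg_le_abs (x i)).trans (hxy i))
    have h3 := h (y i) (hglb.1 ⟨i, rfl⟩)
    rw [← zero_sub, ODual.map_sub, ODual.map_zero] at h2
    exact abs_le.2 ⟨by linarith, by linarith⟩
  exact squeeze_zero_norm hb hlim

/-- If `ψ` is disjoint from the evaluation at `a`, then `f` is approximated at `a` by elements of
`[0, f]` on which `ψ` vanishes. -/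
theorem exists_apply_eq_zero_of_inf_evalBidual {ψ : OBidual E} (hψ : 0 ≤ ψ) {a : E} (ha : 0 ≤ a)
    (h : ψ ⊓ evalBidual a = 0) {f : ODual E} (hf : 0 ≤ f) {ε : ℝ} (hε : 0 < ε) :
    ∃ k : ODual E, 0 ≤ k ∧ k ≤ f ∧ ψ k = 0 ∧ (f - k) a ≤ ε := by
  -- Disjointness at `f` gives such a `g` for any positive error; geometric errors keep the total
  -- loss at `a` below `ε`.
  have hg : ∀ n : ℕ, ∃ g : ODual E, 0 ≤ g ∧ g ≤ f ∧
      ψ g + (f - g) a < ε / 2 * (1 / 2) ^ n := by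
    intro n
    obtain ⟨y, hy, hyx, hlt⟩ := ODual.exists_lt_inf_apply_add ψ (evalBidual a) hf
      (show 0 < ε / 2 * (1 / 2) ^ n by positivity)
    refine ⟨f - y, sub_nonneg.2 hyx, sub_le_self f hy, ?_⟩
    rw [h, ODual.zero_apply, zero_add] at hlt
    rwa [sub_sub_cancel]
  choose g hg0 hgf hgε using hg
  -- The running infima `g 0 ⊓ ⋯ ⊓ g n` form a decreasing sequence, which has a pointwise limit; the
  -- `g n` themselves need not converge.
  let k : ℕ → ODual E := fun n => Nat.rec (g 0) (fun n q => q ⊓ g (n + 1)) n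
  have hks : ∀ n, k (n + 1) = k n ⊓ g (n + 1) := fun n => rfl
  have hk0 : ∀ n, 0 ≤ k n := fun n => by
    induction n with
    | zero => exact hg0 0
    | succ n ih => exact le_inf ih (hg0 _)
  have hkg : ∀ n, k n ≤ g n := fun n => by
    cases n with
    | zero => exact le_rfl
    | succ n => exact inf_le_right
  have hanti : Antitone k := antitone_nat_of_succ_le fun n => inf_le_left
  -- The right side is the sum of `ε / 2 * (1 / 2) ^ i` over `i ≤ n`; the losses add up because `f -
  -- p ⊓ q ≤ (f - p) + (f - q)` for `p, q ≤ f`.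
  have hka : ∀ n, (f - k n) a ≤ ε - ε / 2 * (1 / 2) ^ n := fun n => by
    induction n with
    | zero =>
      have h1 := hgε 0
      have h2 := hψ _ (hg0 0)
      rw [ODual.zero_apply] at h2
      change (f - g 0) a ≤ _
      linarith [pow_zero (1 / 2 : ℝ)]
    | succ n ih =>
      have h1 := hgε (n + 1)
      have h2 := hψ _ (hg0 (n + 1))
      rw [ODual.zero_apply] at h2
      have h3 : f - k (n + 1) ≤ (f - k n) + (f - g (n + 1)) := by
        rw [sub_le_comm, hks]
        have hk' : 0 ≤ f - k n := sub_nonneg.2 ((hkg n).trans (hgf n))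
        have hg' : 0 ≤ f - g (n + 1) := sub_nonneg.2 (hgf (n + 1))
        refine le_inf ?_ ?_
        · rw [sub_le_comm]; exact le_add_of_nonneg_right hg'
        · rw [sub_le_comm]; exact le_add_of_nonneg_left hk'
      have h4 := h3 a ha
      rw [ODual.add_apply] at h4
      rw [pow_succ] at h1 ⊢
      linarith
  obtain ⟨q, hq0, hqk, hlim⟩ := ODual.exists_tendsto_of_antitone k hanti hk0
  have hpow : Tendsto (fun n : ℕ => ε / 2 * (1 / 2 : ℝ) ^ n) atTop (𝓝 0) := by
    simpa using (tendsto_pow_atTop_nhds_zero_of_lt_one (r := (1 / 2 : ℝ)) (by norm_num)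
      (by norm_num)).const_mul (ε / 2)
  refine ⟨q, hq0, (hqk 0).trans (hgf 0), le_antisymm ?_ (hψ q hq0), ?_⟩
  -- Since `q ≤ g n` for every `n`, `ψ q` lies below all the errors; no continuity of `ψ` is needed.
  · refine ge_of_tendsto' hpow fun n => ?_
    have h1 := ODual.mono hψ ((hqk n).trans (hkg n))
    have h2 := (sub_nonneg.2 (hgf n) : 0 ≤ f - g n) a ha
    rw [ODual.zero_apply] at h2
    linarith [hgε n]
  · have h1 : Tendsto (fun n => (f - k n) a) atTop (𝓝 ((f - q) a)) :=
      tendsto_const_nhds.sub (hlim a)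
    refine le_of_tendsto' h1 fun n => (hka n).trans ?_
    have : 0 ≤ ε / 2 * (1 / 2) ^ n := by positivity
    linarith

/-- A positive order continuous functional on the order dual that is disjoint from all evaluations
is zero. -/
theorem eq_zero_of_inf_evalBidual {ψ : OBidual E} (hψ : 0 ≤ ψ) (hc : IsOrderContinuous ψ)
    (h : ∀ a : E, 0 ≤ a → ψ ⊓ evalBidual a = 0) {f : ODual E} (hf : 0 ≤ f) : ψ f = 0 := by
  -- The null elements of `ψ` in `[0, f]`, directed upwards because `ψ (k ⊔ l) ≤ ψ k + ψ l = 0`.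
  let N : Type u := {k : ODual E // 0 ≤ k ∧ k ≤ f ∧ ψ k = 0}
  have : Nonempty N := ⟨⟨0, le_rfl, hf, ODual.map_zero ψ⟩⟩
  have : IsDirectedOrder N := ⟨fun k l => by
    refine ⟨⟨k.1 ⊔ l.1, k.2.1.trans le_sup_left, sup_le k.2.2.1 l.2.2.1, le_antisymm ?_ ?_⟩,
      le_sup_left (a := k.1), le_sup_right (a := k.1)⟩
    · have h1 := ODual.mono hψ (sup_le (le_add_of_nonneg_right l.2.1)
        (le_add_of_nonneg_left k.2.1) : k.1 ⊔ l.1 ≤ k.1 + l.1)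
      rwa [ODual.map_add, k.2.2.2, l.2.2.2, add_zero] at h1
    · exact hψ _ (k.2.1.trans le_sup_left)⟩
  -- The preceding lemma makes `(f - k) x` arbitrarily small at each `x ≥ 0`, with `k` allowed to
  -- depend on `x`.
  have hglb : IsGLB (Set.range fun k : N => f - k.1) 0 := by
    refine ⟨by rintro _ ⟨k, rfl⟩; exact sub_nonneg.2 k.2.2.1, fun b hb x hx => ?_⟩
    refine le_of_forall_pos_le_add fun ε hε => ?_
    obtain ⟨k, hk0, hkf, hk, hkε⟩ := exists_apply_eq_zero_of_inf_evalBidual hψ hx (h x hx) hf hε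
    rw [ODual.zero_apply, zero_add]
    exact (hb ⟨⟨k, hk0, hkf, hk⟩, rfl⟩ x hx).trans hkε
  have hlim := hc.tendsto_of_antitone (fun k l hkl => sub_le_sub_left (show k.1 ≤ l.1 from hkl) f) hglb
  -- Along this net `ψ (f - k)` is constantly `ψ f`, while order continuity sends it to zero.
  refine tendsto_nhds_unique (tendsto_const_nhds.congr fun k : N => ?_) hlim
  rw [ODual.map_sub, k.2.2.2, sub_zero]

/-- A positive order continuous functional on the order dual is approximated by its infima with the
evaluations at positive points. -/
theorem tendsto_sub_inf_evalBidual {φ : OBidual E} (hφ : 0 ≤ φ) (hc : IsOrderContinuous φ)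
    {f : ODual E} (hf : 0 ≤ f) :
    Tendsto (fun a : {a : E // 0 ≤ a} => (φ - φ ⊓ evalBidual a.1) f) atTop (𝓝 0) := by
  have : Nonempty {a : E // 0 ≤ a} := ⟨⟨0, le_rfl⟩⟩
  have : IsDirectedOrder {a : E // 0 ≤ a} :=
    ⟨fun a b => ⟨⟨a.1 ⊔ b.1, a.2.trans le_sup_left⟩, le_sup_left (a := a.1),
      le_sup_right (a := a.1)⟩⟩
  -- The remainders decrease to some `ψ`; it remains to see that `ψ` is disjoint from every
  -- evaluation.
  obtain ⟨ψ, hψ0, hψ, hlim⟩ := ODual.exists_tendsto_of_antitone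
    (fun a : {a : E // 0 ≤ a} => φ - φ ⊓ evalBidual a.1)
    (fun a b hab => sub_le_sub_left (inf_le_inf_left φ (evalBidual_mono hab)) φ)
    (fun a => sub_nonneg.2 inf_le_left)
  have hψφ : ψ ≤ φ := (hψ ⟨0, le_rfl⟩).trans
    (sub_le_self φ (le_inf hφ (evalBidual_nonneg le_rfl)))
  suffices h : ψ f = 0 by
    rw [← h]
    exact hlim f
  refine eq_zero_of_inf_evalBidual hψ0 (hc.of_le hψ0 hψφ) (fun a ha => ?_) hf
  have hω0 : 0 ≤ ψ ⊓ evalBidual a := le_inf hψ0 (evalBidual_nonneg ha)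
  -- Since `ψ ≤ φ - φ ⊓ evalBidual (n • a)`, one more copy of `ψ ⊓ evalBidual a` always fits under
  -- `φ`. All its multiples are then below `φ`, which forces it to vanish.
  have hn : ∀ n : ℕ, n • (ψ ⊓ evalBidual a) ≤ φ ⊓ evalBidual (n • a) := fun n => by
    induction n with
    | zero => simpa using le_inf hφ (evalBidual_nonneg (le_refl (0 : E)))
    | succ n ih =>
      rw [succ_nsmul]
      refine le_inf ?_ ?_
      · have h1 := hψ ⟨n • a, nsmul_nonneg ha n⟩
        rw [le_sub_iff_add_le] at h1
        rw [add_comm]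
        exact (add_le_add inf_le_left ih).trans h1
      · rw [succ_nsmul, evalBidual_add]
        exact add_le_add (ih.trans inf_le_right) inf_le_right
  refine le_antisymm (fun g hg => ?_) hω0
  rw [ODual.zero_apply]
  by_contra! hpos
  obtain ⟨n, hlt⟩ := exists_lt_nsmul hpos (φ g)
  have h1 := (hn n).trans inf_le_left g hg
  rw [← Nat.cast_smul_eq_nsmul ℝ, ODual.smul_apply] at h1
  rw [nsmul_eq_mul] at hlt
  linarith

end Functionals

/-! ### Adjoints and biadjoints of Riesz homomorphisms -/

section RieszHom

variable {E : Type u} {F : Type v}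
  [AddCommGroup E] [Lattice E] [IsOrderedAddMonoid E] [Module ℝ E] [IsOrderedModule ℝ E]
  [AddCommGroup F] [Lattice F] [IsOrderedAddMonoid F] [Module ℝ F] [IsOrderedModule ℝ F]

theorem abs_smul_of_pos {c : ℝ} (hc : 0 < c) (x : E) : |c • x| = c • |x| := by
  have le : ∀ (c : ℝ) (x : E), 0 < c → |c • x| ≤ c • |x| := fun c x hc =>
    abs_le'.2 ⟨smul_le_smul_of_nonneg_left (le_abs_self x) hc.le, by
      rw [← smul_neg]
      exact smul_le_smul_of_nonneg_left (neg_le_abs x) hc.le⟩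
  refine le_antisymm (le c x hc) ?_
  have h := smul_le_smul_of_nonneg_left (le c⁻¹ (c • x) (inv_pos.2 hc)) hc.le
  rwa [smul_smul, inv_mul_cancel₀ hc.ne', one_smul, smul_smul, mul_inv_cancel₀ hc.ne',
    one_smul] at h

/-- The adjoint of a Riesz homomorphism is interval preserving. -/
theorem exists_comp_eq_of_le (T : E →ₗ[ℝ] F) (hT : ∀ x, |T x| = T |x|) {y : ODual F} (hy : 0 ≤ y)
    {g : ODual E} (hg : 0 ≤ g) (hgy : ∀ x, 0 ≤ x → g x ≤ y (T x)) :
    ∃ u : ODual F, 0 ≤ u ∧ u ≤ y ∧ ∀ x, g x = u (T x) := by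
  -- If `T x = 0`, then `|g x| ≤ g |x| ≤ y (T |x|) = y |T x| = 0`; so `g` descends to the range of
  -- `T`.
  have hker : LinearMap.ker T ≤ LinearMap.ker (ODual.toLin g) := by
    intro x hx
    rw [LinearMap.mem_ker] at hx ⊢
    have h0 : T |x| = 0 := by rw [← hT, hx, abs_zero]
    have h1 := hgy _ (abs_nonneg x)
    rw [h0, ODual.map_zero] at h1
    have h2 := ODual.mono hg (le_abs_self x)
    have h3 := ODual.mono hg (neg_le_abs x)
    rw [← zero_sub, ODual.map_sub, ODual.map_zero] at h3
    exact le_antisymm (by linarith) (by linarith)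
  let f : F →ₗ.[ℝ] ℝ :=
    ⟨LinearMap.range T, (LinearMap.ker T).liftQ (ODual.toLin g) hker ∘ₗ
      T.quotKerEquivRange.symm.toLinearMap⟩
  have hf : ∀ x, f ⟨T x, LinearMap.mem_range_self T x⟩ = g x := fun x => by
    change (LinearMap.ker T).liftQ (ODual.toLin g) hker (T.quotKerEquivRange.symm _) = _
    rw [LinearMap.quotKerEquivRange_symm_apply_image, Submodule.mkQ_apply, Submodule.liftQ_apply]
  -- The sublinear majorant is `z ↦ y z⁺`, as `(z + |z|) / 2 = z⁺`. For `z ≥ 0` it equals `y z` at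
  -- `z`, so `u z ≤ y z`, and zero at `-z`, so `u z ≥ 0`.
  obtain ⟨u, hu, hup⟩ := exists_extension_of_le_sublinear f (fun z => (y z + y |z|) / 2)
    (fun c hc z => by
      rw [abs_smul_of_pos hc, ODual.map_smul, ODual.map_smul]
      ring)
    (fun z w => by
      have h := ODual.mono hy (abs_add_le z w)
      rw [ODual.map_add] at h
      rw [ODual.map_add]
      linarith)
    (by
      rintro ⟨_, x, rfl⟩
      rw [hf]
      have h1 := hgy _ (posPart_nonneg x)
      have h2 : g x ≤ g x⁺ := ODual.mono hg (le_posPart x)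
      have h3 : y (T x) = y (T x⁺) - y (T x⁻) := by
        rw [← ODual.map_sub, ← map_sub, posPart_sub_negPart]
      have h4 : y |T x| = y (T x⁺) + y (T x⁻) := by
        rw [← ODual.map_add, ← map_add, posPart_add_negPart, hT]
      change g x ≤ (y (T x) + y |T x|) / 2
      linarith)
  have hu0 : ∀ z, 0 ≤ z → 0 ≤ u z := fun z hz => by
    have h := hup (-z)
    rw [abs_neg, abs_of_nonneg hz, ← ODual.map_add, neg_add_cancel, ODual.map_zero, map_neg] at h
    linarith
  refine ⟨⟨u, mem_orderBounded_of_pos u hu0⟩, hu0, fun z hz => ?_, fun x => ?_⟩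
  · have h := hup z
    rw [abs_of_nonneg hz, add_self_div_two] at h
    exact h
  · rw [← hf x]
    exact (hu ⟨T x, LinearMap.mem_range_self T x⟩).symm

/-- The biadjoint of a Riesz homomorphism preserves disjointness. -/
theorem exists_split_of_inf_eq_zero (T : E →ₗ[ℝ] F) (hT : ∀ x, |T x| = T |x|) {φ ψ : OBidual E}
    (h : φ ⊓ ψ = 0) {y : ODual F} (hy : 0 ≤ y) {f : ODual E} (hf : 0 ≤ f)
    (hfy : ∀ x, f x = y (T x)) {ε : ℝ} (hε : 0 < ε) :
    ∃ (u : ODual F) (g : ODual E), 0 ≤ u ∧ u ≤ y ∧ (∀ x, g x = u (T x)) ∧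
      φ (f - g) + ψ g < ε := by
  -- A near-optimal splitting of `f` for `φ ⊓ ψ = 0`; interval preservation lifts `g` to a
  -- functional below `y`.
  obtain ⟨g, hg, hgf, hlt⟩ := ODual.exists_lt_inf_apply_add φ ψ hf hε
  rw [h, ODual.zero_apply, zero_add] at hlt
  obtain ⟨u, hu, huy, hgu⟩ := exists_comp_eq_of_le T hT hy hg fun x hx => by
    rw [← hfy]
    exact hgf x hx
  exact ⟨u, g, hu, huy, hgu, hlt⟩

end RieszHom

/-! ### Successive elimination of variables -/

section ElimAll

theorem elimAll_nonneg : ∀ {n : ℕ} {E : Fin n → Type u}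
    [∀ i, AddCommGroup (E i)] [∀ i, Lattice (E i)] [∀ i, IsOrderedAddMonoid (E i)]
    [∀ i, Module ℝ (E i)] [∀ i, IsOrderedModule ℝ (E i)]
    {w : ∀ i, OBidual (E i)} (_ : ∀ i, 0 ≤ w i) {B : regularOps E ℝ} (_ : IsPositive B.1),
    0 ≤ elimAll w B
  | 0, _, _, _, _, _, _, _, _, _, hB => hB _ fun i => i.elim0
  | _ + 1, _, _, _, _, _, _, _, hw, _, hB =>
    elimAll_nonneg (fun i => hw i.succ) (elim_nonneg (hw 0) hB)

theorem elim_sub {n : ℕ} {E : Fin (n + 1) → Type u}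
    [∀ i, AddCommGroup (E i)] [∀ i, Lattice (E i)] [∀ i, IsOrderedAddMonoid (E i)]
    [∀ i, Module ℝ (E i)] [∀ i, IsOrderedModule ℝ (E i)]
    (x y : OBidual (E 0)) (A : regularOps E ℝ) : elim (x - y) A = elim x A - elim y A := rfl

theorem elim_form_sub {n : ℕ} {E : Fin (n + 1) → Type u}
    [∀ i, AddCommGroup (E i)] [∀ i, Lattice (E i)] [∀ i, IsOrderedAddMonoid (E i)]
    [∀ i, Module ℝ (E i)] [∀ i, IsOrderedModule ℝ (E i)]
    (x : OBidual (E 0)) (A B : regularOps E ℝ) : elim x (A - B) = elim x A - elim x B :=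
  map_sub (elim x) A B

theorem elimAll_sub {n : ℕ} {E : Fin n → Type u}
    [∀ i, AddCommGroup (E i)] [∀ i, Lattice (E i)] [∀ i, IsOrderedAddMonoid (E i)]
    [∀ i, Module ℝ (E i)] [∀ i, IsOrderedModule ℝ (E i)]
    (w : ∀ i, OBidual (E i)) (A B : regularOps E ℝ) :
    elimAll w (A - B) = elimAll w A - elimAll w B :=
  map_sub (elimAll w) A B

/-- The tail is enlarged first, with `w 0` kept in front; then `w 0` grows to `z 0`, the gain coming
from the positive functional `z 0 - w 0`. -/
theorem elimAll_mono : ∀ {n : ℕ} {E : Fin n → Type u}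
    [∀ i, AddCommGroup (E i)] [∀ i, Lattice (E i)] [∀ i, IsOrderedAddMonoid (E i)]
    [∀ i, Module ℝ (E i)] [∀ i, IsOrderedModule ℝ (E i)]
    {w z : ∀ i, OBidual (E i)} (_ : ∀ i, 0 ≤ w i) (_ : ∀ i, w i ≤ z i) {B : regularOps E ℝ}
    (_ : IsPositive B.1), elimAll w B ≤ elimAll z B
  | 0, _, _, _, _, _, _, _, _, _, _, _, _ => le_rfl
  | _ + 1, _, _, _, _, _, _, w, z, hw, hwz, B, hB => by
    have h1 : elimAll (fun i => w i.succ) (elim (w 0) B) ≤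
        elimAll (fun i => z i.succ) (elim (w 0) B) :=
      elimAll_mono (fun i => hw i.succ) (fun i => hwz i.succ) (elim_nonneg (hw 0) hB)
    have h2 : 0 ≤ elimAll (fun i => z i.succ) (elim (z 0 - w 0) B) :=
      elimAll_nonneg (fun i => (hw i.succ).trans (hwz i.succ))
        (elim_nonneg (sub_nonneg.2 (hwz 0)) hB)
    rw [elim_sub, elimAll_sub, sub_nonneg] at h2
    exact h1.trans h2

/-- Eliminating variables by positive order continuous functionals is continuous along antitone
nets of positive forms. -/
theorem tendsto_elimAll : ∀ {n : ℕ} {E : Fin n → Type u}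
    [∀ i, AddCommGroup (E i)] [∀ i, Lattice (E i)] [∀ i, IsOrderedAddMonoid (E i)]
    [∀ i, Module ℝ (E i)] [∀ i, IsOrderedModule ℝ (E i)]
    {w : ∀ i, OBidual (E i)} (_ : ∀ i, 0 ≤ w i) (_ : ∀ i, IsOrderContinuous (w i))
    {ι : Type u} [Preorder ι] [IsDirectedOrder ι] [Nonempty ι] {B : ι → regularOps E ℝ}
    (_ : ∀ i, IsPositive (B i).1) (_ : ∀ i j, i ≤ j → IsPositive (B i - B j).1)
    (_ : ∀ x, (∀ k, 0 ≤ x k) → Tendsto (fun i => (B i).1 x) atTop (𝓝 0)),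
    Tendsto (fun i => elimAll w (B i)) atTop (𝓝 0)
  | 0, _, _, _, _, _, _, _, _, _, _, _, _, _, _, _, _, h => h _ fun i => i.elim0
  | n + 1, E, _, _, _, _, _, w, hw, hc, ι, _, _, _, B, hB, hanti, h => by
    refine tendsto_elimAll (B := fun i => elim (w 0) (B i)) (fun i => hw i.succ)
      (fun i => hc i.succ) (fun i => elim_nonneg (hw 0) (hB i)) (fun i j hij => ?_) fun x hx => ?_
    · rw [← elim_form_sub]
      exact elim_nonneg (hw 0) (hanti i j hij)
    · have hcons : ∀ t, 0 ≤ t → ∀ k, 0 ≤ (Fin.cons t x : ∀ i, E i) k := fun t ht =>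
        Fin.cases ht hx
      -- For fixed `x` the slices are an antitone net in the order dual of `E 0` with infimum zero,
      -- so order continuity of `w 0` passes the pointwise convergence on to the forms with one
      -- variable fewer.
      have hpos : ∀ i, 0 ≤ (slice (B i)).1 x := fun i t ht => hB i _ (hcons t ht)
      refine (hc 0).tendsto_of_antitone (y := fun i => (slice (B i)).1 x) (fun i j hij t ht => ?_)
        (isGLB_zero_of_tendsto hpos fun t ht => h _ (hcons t ht))
      exact sub_nonneg.1 (hanti i j hij _ (hcons t ht))

/-- Elimination by order continuous functionals is approximated by elimination by functionals in
the ideals generated by evaluations. -/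
theorem exists_elimAll_inf_evalBidual : ∀ {n : ℕ} {E : Fin n → Type u}
    [∀ i, AddCommGroup (E i)] [∀ i, Lattice (E i)] [∀ i, IsOrderedAddMonoid (E i)]
    [∀ i, Module ℝ (E i)] [∀ i, IsOrderedModule ℝ (E i)]
    {w : ∀ i, OBidual (E i)} (_ : ∀ i, 0 ≤ w i) (_ : ∀ i, IsOrderContinuous (w i))
    {B : regularOps E ℝ} (_ : IsPositive B.1) {ε : ℝ} (_ : 0 < ε),
    ∃ a : ∀ i, E i, (∀ i, 0 ≤ a i) ∧
      elimAll w B ≤ elimAll (fun i => w i ⊓ evalBidual (a i)) B + ε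
  | 0, _, _, _, _, _, _, _, _, _, _, _, _, hε =>
    ⟨fun i => i.elim0, fun i => i.elim0, le_add_of_nonneg_right hε.le⟩
  | n + 1, E, _, _, _, _, _, w, hw, hc, B, hB, ε, hε => by
    have : Nonempty {a : E 0 // 0 ≤ a} := ⟨⟨0, le_rfl⟩⟩
    have : IsDirectedOrder {a : E 0 // 0 ≤ a} :=
      ⟨fun a b => ⟨⟨a.1 ⊔ b.1, a.2.trans le_sup_left⟩, le_sup_left (a := a.1),
        le_sup_right (a := a.1)⟩⟩
    -- Cutting off the first functional leaves the forms `elim (w 0 - w 0 ⊓ evalBidual a) B`, which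
    -- decrease pointwise to zero on positive arguments.
    have hlim := tendsto_elimAll (fun i : Fin n => hw i.succ) (fun i => hc i.succ)
      (B := fun a : {a : E 0 // 0 ≤ a} => elim (w 0 - w 0 ⊓ evalBidual a.1) B)
      (fun a => elim_nonneg (sub_nonneg.2 inf_le_left) hB)
      (fun a b hab => by
        rw [← elim_sub]
        exact elim_nonneg (sub_nonneg.2 (sub_le_sub_left
          (inf_le_inf_left (w 0) (evalBidual_mono hab)) (w 0))) hB)
      (fun x hx => tendsto_sub_inf_evalBidual (hw 0) (hc 0)
        (f := (slice B).1 x) fun t ht => hB _ (Fin.cases ht hx))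
    obtain ⟨a₀, ha₀⟩ := (hlim.eventually (gt_mem_nhds (half_pos hε))).exists
    have hpos : 0 ≤ w 0 ⊓ evalBidual a₀.1 := le_inf (hw 0) (evalBidual_nonneg a₀.2)
    -- The remaining points are chosen for the form already truncated at `a₀`, so no uniformity in
    -- `a₀` is required.
    obtain ⟨a, ha, hle⟩ := exists_elimAll_inf_evalBidual (fun i : Fin n => hw i.succ)
      (fun i => hc i.succ) (elim_nonneg hpos hB) (half_pos hε)
    refine ⟨Fin.cons a₀.1 a, Fin.cases a₀.2 ha, ?_⟩
    change elimAll (fun i : Fin n => w i.succ) (elim (w 0) B) ≤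
      elimAll (fun i : Fin n => w i.succ ⊓ evalBidual (a i)) (elim (w 0 ⊓ evalBidual a₀.1) B) + ε
    rw [elim_sub, elimAll_sub] at ha₀
    linarith

theorem elimAll_evalBidual : ∀ {n : ℕ} {E : Fin n → Type u}
    [∀ i, AddCommGroup (E i)] [∀ i, Lattice (E i)] [∀ i, IsOrderedAddMonoid (E i)]
    [∀ i, Module ℝ (E i)] [∀ i, IsOrderedModule ℝ (E i)]
    (a : ∀ i, E i) (B : regularOps E ℝ), elimAll (fun i => evalBidual (a i)) B = B.1 a
  | 0, _, _, _, _, _, _, a, B => congrArg B.1 (funext fun i => i.elim0)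
  | _ + 1, _, _, _, _, _, _, a, B =>
    (elimAll_evalBidual (fun i => a i.succ) (elim (evalBidual (a 0)) B)).trans
      (congrArg B.1 (Fin.cons_self_tail a))

/-- Eliminating all variables but one by evaluations. -/
theorem elimAll_update_evalBidual : ∀ {n : ℕ} {E : Fin n → Type u}
    [∀ i, AddCommGroup (E i)] [∀ i, Lattice (E i)] [∀ i, IsOrderedAddMonoid (E i)]
    [∀ i, Module ℝ (E i)] [∀ i, IsOrderedModule ℝ (E i)]
    (a : ∀ i, E i) (j : Fin n) (u : OBidual (E j)) (f : ODual (E j)) (B : regularOps E ℝ)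
    (_ : ∀ t, f t = B.1 (Function.update a j t)),
    elimAll (Function.update (fun i => evalBidual (a i)) j u) B = u f
  | 0, _, _, _, _, _, _, _, j, _, _, _, _ => j.elim0
  | n + 1, E, _, _, _, _, _, a, j, u, f, B, h => by
    induction j using Fin.cases with
    | zero =>
      have e : (fun i : Fin n => Function.update (fun i => evalBidual (a i)) 0 u i.succ) =
          fun i : Fin n => evalBidual (a i.succ) := by
        funext i
        simp
      change elimAll (fun i : Fin n => Function.update (fun i => evalBidual (a i)) 0 u i.succ)
        (elim (Function.update (fun i => evalBidual (a i)) 0 u 0) B) = u f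
      rw [e, Function.update_self, elimAll_evalBidual, elim_apply]
      congr 1
      ext t
      rw [slice_apply, h, ← Fin.cons_self_tail (Function.update a 0 t), Function.update_self,
        Fin.tail_update_zero]
      rfl
    | succ j =>
      have e : (fun i : Fin n => Function.update (fun i => evalBidual (a i)) j.succ u i.succ) =
          Function.update (fun i : Fin n => evalBidual (a i.succ)) j u := by
        funext i
        exact congrFun (Function.update_comp_eq_of_injective' (fun i => evalBidual (a i))
          (Fin.succ_injective n) j u) i
      change elimAll (fun i : Fin n => Function.update (fun i => evalBidual (a i)) j.succ u i.succ)
        (elim (Function.update (fun i => evalBidual (a i)) j.succ u 0) B) = u f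
      rw [e, Function.update_of_ne (Fin.succ_ne_zero j).symm]
      refine elimAll_update_evalBidual (fun i => a i.succ) j u f _ fun t => ?_
      rw [h, elim_apply, evalBidual_apply, slice_apply, ← Fin.cons_self_tail (Function.update a _ t),
        Function.update_of_ne (Fin.succ_ne_zero j).symm, Fin.tail_update_succ]
      rfl

end ElimAll

/-! ### Disjointness and absolute values -/

section Disjoint

/-- For disjoint elements `|a| + |b| = |a| ⊔ |b|`. Moreover `|a| - |a - b|` lies below both `|a|`
and `|b|`, hence below zero, and symmetrically for `b`. -/
theorem abs_sub_eq_of_inf_abs_eq_zero {G : Type*} [AddCommGroup G] [Lattice G]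
    [IsOrderedAddMonoid G] {a b : G} (h : |a| ⊓ |b| = 0) : |a - b| = |a| + |b| := by
  refine le_antisymm (by simpa [sub_eq_add_neg] using abs_add_le a (-b)) ?_
  rw [← inf_add_sup |a| |b|, h, zero_add]
  have key : ∀ a b : G, |a| ⊓ |b| = 0 → |a| ≤ |a - b| := fun a b h => by
    have h1 : |a| ≤ |a - b| + |b| := by simpa using abs_add_le (a - b) b
    have h2 : |a| - |b| ≤ |a - b| := sub_le_iff_le_add.2 h1
    have h3 : |a| - |a - b| ≤ |a| ⊓ |b| :=
      le_inf (sub_le_self _ (abs_nonneg _)) (sub_le_comm.1 h2)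
    rwa [h, sub_nonpos] at h3
  refine sup_le (key a b h) ?_
  rw [abs_sub_comm]
  exact key b a (by rwa [inf_comm])

/-- A positive multilinear operator that preserves disjointness in each variable commutes with
absolute values. -/
theorem IsPositive.abs_apply_of_disjoint {n : ℕ} {G : Fin n → Type*} {H : Type*}
    [∀ i, AddCommGroup (G i)] [∀ i, Lattice (G i)] [∀ i, IsOrderedAddMonoid (G i)]
    [∀ i, Module ℝ (G i)] [AddCommGroup H] [Lattice H] [IsOrderedAddMonoid H] [Module ℝ H]
    {B : MultilinearMap ℝ G H} (hB : IsPositive B)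
    (hd : ∀ x : ∀ i, G i, (∀ i, 0 ≤ x i) → ∀ (j : Fin n) (u v : G j), 0 ≤ u → 0 ≤ v → u ⊓ v = 0 →
      B (Function.update x j u) ⊓ B (Function.update x j v) = 0) (x : ∀ i, G i) :
    |B x| = B (fun i => |x i|) := by
  -- Induction on the set `s` of coordinates whose sign is unrestricted.
  have key : ∀ s : Finset (Fin n), ∀ x : ∀ i, G i, (∀ i ∉ s, 0 ≤ x i) →
      |B x| = B (fun i => |x i|) := by
    intro s
    induction s using Finset.induction_on with
    | empty =>
      intro x hx
      have hx' : ∀ i, 0 ≤ x i := fun i => hx i (by simp)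
      rw [abs_of_nonneg (hB x hx')]
      exact congrArg B (funext fun i => (abs_of_nonneg (hx' i)).symm)
    | insert j s hj ih =>
      intro x hx
      have aux : ∀ a : G j, 0 ≤ a →
          |B (Function.update x j a)| = B (Function.update (fun i => |x i|) j a) := by
        intro a ha
        have h := ih (Function.update x j a) (fun i hi => by
          rcases eq_or_ne i j with rfl | hij
          · simpa using ha
          · simpa [hij] using hx i (by simp [hij, hi]))
        have e : (fun i => |Function.update x j a i|) = Function.update (fun i => |x i|) j a := by
          funext i
          rcases eq_or_ne i j with rfl | hij
          · simp [abs_of_nonneg ha]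
          · simp [hij]
        rwa [e] at h
      have h1 : B x = B (Function.update x j (x j)⁺) - B (Function.update x j (x j)⁻) := by
        rw [← MultilinearMap.map_update_sub, posPart_sub_negPart, Function.update_eq_self]
      have h2 : B (fun i => |x i|) = B (Function.update (fun i => |x i|) j (x j)⁺)
          + B (Function.update (fun i => |x i|) j (x j)⁻) := by
        rw [← MultilinearMap.map_update_add, posPart_add_negPart,
          Function.update_eq_self j (fun i => |x i|)]
      rw [h1, h2, abs_sub_eq_of_inf_abs_eq_zero, aux _ (posPart_nonneg _),
        aux _ (negPart_nonneg _)]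
      -- By `aux`, the absolute values of the two pieces are values of `B` with all other arguments
      -- positive, so `hd` applies to `(x j)⁺` and `(x j)⁻`.
      rw [aux _ (posPart_nonneg _), aux _ (negPart_nonneg _)]
      exact hd _ (fun i => abs_nonneg (x i)) j _ _ (posPart_nonneg _) (negPart_nonneg _)
        (posPart_inf_negPart_eq_zero (x j))
  exact key Finset.univ x (fun i hi => absurd (Finset.mem_univ i) hi)

end Disjoint

/-! ### The Arens extension of a Riesz multimorphism -/

section ArensExtension

variable {n : ℕ} {E : Fin n → Type u}
  [∀ i, AddCommGroup (E i)] [∀ i, Lattice (E i)] [∀ i, IsOrderedAddMonoid (E i)]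
  [∀ i, Module ℝ (E i)] [∀ i, IsOrderedModule ℝ (E i)]
  {F : Type v} [AddCommGroup F] [Lattice F] [IsOrderedAddMonoid F]
  [Module ℝ F] [IsOrderedModule ℝ F]

theorem exists_comp_perm_eq (ρ : Equiv.Perm (Fin n)) (z : ∀ k, E (ρ k)) :
    ∃ w : ∀ i, E i, (fun k => w (ρ k)) = z :=
  ⟨(Equiv.piCongrLeft' E ρ.symm).symm z, (Equiv.piCongrLeft' E ρ.symm).apply_symm_apply z⟩

theorem isPositive_permute_compDual (ρ : Equiv.Perm (Fin n)) {A : regularOps E F}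
    (hA : IsPositive A.1) {y : ODual F} (hy : 0 ≤ y) : IsPositive (permute ρ (compDual y A)).1 := by
  intro z hz
  obtain ⟨w, rfl⟩ := exists_comp_perm_eq ρ z
  rw [permute_apply]
  exact hy _ (hA w fun i => by
    obtain ⟨k, rfl⟩ := ρ.surjective i
    exact hz k)

theorem arens_apply (ρ : Equiv.Perm (Fin n)) (A : regularOps E F) (w : ∀ i, OBidual (E i))
    (y : ODual F) :
    arens ρ A w y = elimAll (fun k => w (ρ k)) (permute ρ (compDual y A)) := rfl

theorem arens_nonneg (ρ : Equiv.Perm (Fin n)) {A : regularOps E F} (hA : IsPositive A.1)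
    {w : ∀ i, OBidual (E i)} (hw : ∀ i, 0 ≤ w i) : 0 ≤ arens ρ A w := fun _ hy =>
  elimAll_nonneg (fun k => hw (ρ k)) (isPositive_permute_compDual ρ hA hy)

theorem arens_mono (ρ : Equiv.Perm (Fin n)) {A : regularOps E F} (hA : IsPositive A.1)
    {w z : ∀ i, OBidual (E i)} (hw : ∀ i, 0 ≤ w i) (hwz : ∀ i, w i ≤ z i) :
    arens ρ A w ≤ arens ρ A z := fun _ hy =>
  elimAll_mono (fun k => hw (ρ k)) (fun k => hwz (ρ k)) (isPositive_permute_compDual ρ hA hy)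

theorem exists_arens_inf_evalBidual (ρ : Equiv.Perm (Fin n)) {A : regularOps E F}
    (hA : IsPositive A.1) {w : ∀ i, OBidual (E i)} (hw : ∀ i, 0 ≤ w i)
    (hc : ∀ i, IsOrderContinuous (w i)) {y : ODual F} (hy : 0 ≤ y) {ε : ℝ} (hε : 0 < ε) :
    ∃ a : ∀ i, E i, (∀ i, 0 ≤ a i) ∧
      arens ρ A w y ≤ arens ρ A (fun i => w i ⊓ evalBidual (a i)) y + ε := by
  obtain ⟨a, ha, hle⟩ := exists_elimAll_inf_evalBidual (fun k => hw (ρ k)) (fun k => hc (ρ k))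
    (isPositive_permute_compDual ρ hA hy) hε
  obtain ⟨a, rfl⟩ := exists_comp_perm_eq ρ a
  refine ⟨a, fun i => ?_, hle⟩
  obtain ⟨k, rfl⟩ := ρ.surjective i
  exact ha k

/-- Evaluations merely substitute points, so `ρ` disappears and only `u` acts on the partial
operator of `A`: this is its biadjoint at `u`. The functional `f` enters through its values, which
spares a proof of order boundedness in the statement. -/
theorem arens_update_evalBidual (ρ : Equiv.Perm (Fin n)) (A : regularOps E F) (a : ∀ i, E i)
    (j : Fin n) (u : OBidual (E j)) (y : ODual F) (f : ODual (E j))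
    (h : ∀ t, f t = y (A.1 (Function.update a j t))) :
    arens ρ A (Function.update (fun i => evalBidual (a i)) j u) y = u f := by
  obtain ⟨k, rfl⟩ := ρ.surjective j
  rw [arens_apply]
  have e : (fun l => Function.update (fun i => evalBidual (a i)) (ρ k) u (ρ l)) =
      Function.update (fun l => evalBidual (a (ρ l))) k u :=
    Function.update_comp_eq_of_injective' (fun i => evalBidual (a i)) ρ.injective k u
  rw [e]
  refine elimAll_update_evalBidual (fun l => a (ρ l)) k u f _ fun t => ?_
  have e' : Function.update (fun l => a (ρ l)) k t =
      fun l => Function.update a (ρ k) t (ρ l) :=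
    (Function.update_comp_eq_of_injective' a ρ.injective k t).symm
  rw [e', permute_apply, h]
  rfl

theorem IsRieszMultimorphism.isPositive {A : MultilinearMap ℝ E F} (hA : IsRieszMultimorphism A) :
    IsPositive A := fun x hx => by
  have h := hA.abs_apply x
  rw [show (fun i => |x i|) = x from funext fun i => abs_of_nonneg (hx i)] at h
  rw [← h]
  exact abs_nonneg _

/-- On positive order continuous functionals, the Arens extension of a Riesz multimorphism preserves
disjointness in each variable. -/
theorem arens_update_inf_eq_zero (ρ : Equiv.Perm (Fin n)) {A : MultilinearMap ℝ E F}
    (hA : IsRieszMultimorphism A) {x : ∀ i, OBidual (E i)} (hx : ∀ i, 0 ≤ x i)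
    (hxc : ∀ i, IsOrderContinuous (x i)) (j : Fin n) {u v : OBidual (E j)} (hu : 0 ≤ u)
    (hv : 0 ≤ v) (huc : IsOrderContinuous u) (hvc : IsOrderContinuous v) (huv : u ⊓ v = 0) :
    arens ρ ⟨A, hA.mem_regular⟩ (Function.update x j u) ⊓
      arens ρ ⟨A, hA.mem_regular⟩ (Function.update x j v) = 0 := by
  have hpos := hA.isPositive
  set A' : regularOps E F := ⟨A, hA.mem_regular⟩
  have hw : ∀ w : OBidual (E j), 0 ≤ w → ∀ i, 0 ≤ Function.update x j w i := fun w hw i => by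
    rcases eq_or_ne i j with rfl | hij
    · simpa using hw
    · simpa [hij] using hx i
  have hwc : ∀ w : OBidual (E j), IsOrderContinuous w →
      ∀ i, IsOrderContinuous (Function.update x j w i) := fun w hw i => by
    rcases eq_or_ne i j with rfl | hij
    · simpa using hw
    · simpa [hij] using hxc i
  refine le_antisymm (fun y hy => ?_)
    (le_inf (arens_nonneg ρ hpos (hw u hu)) (arens_nonneg ρ hpos (hw v hv)))
  refine le_of_forall_pos_le_add fun ε hε => ?_
  rw [ODual.zero_apply, zero_add]
  obtain ⟨a, ha, hau⟩ := exists_arens_inf_evalBidual ρ (A := A') hpos (hw u hu) (hwc u huc) hy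
    (show 0 < ε / 3 by positivity)
  obtain ⟨c, hc, hcv⟩ := exists_arens_inf_evalBidual ρ (A := A') hpos (hw v hv) (hwc v hvc) hy
    (show 0 < ε / 3 by positivity)
  -- The truncation points found for `u` and for `v` differ; a common upper bound lets one operator
  -- `T` serve both.
  let b : ∀ i, E i := fun i => a i ⊔ c i
  have hb : ∀ i, 0 ≤ b i := fun i => (ha i).trans le_sup_left
  let T : E j →ₗ[ℝ] F := A.toLinearMap b j
  have hTabs : ∀ t : E j, |T t| = T |t| := fun t => by
    refine (hA.abs_apply (Function.update b j t)).trans (congrArg A (funext fun i => ?_))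
    rcases eq_or_ne i j with rfl | hij
    · simp
    · simp [hij, abs_of_nonneg (hb i)]
  have hTpos : ∀ t : E j, 0 ≤ t → 0 ≤ T t := fun t ht => by
    rw [← abs_of_nonneg ht, ← hTabs]
    exact abs_nonneg _
  have hf0 : ∀ t, 0 ≤ t → 0 ≤ (ODual.toLin y ∘ₗ T) t := fun t ht => hy _ (hTpos t ht)
  let f : ODual (E j) := ⟨ODual.toLin y ∘ₗ T, mem_orderBounded_of_pos _ hf0⟩
  -- Here `f = y ∘ T`, so the splitting `f = (f - g) + g` lifts to `y = (y - z) + z`.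
  obtain ⟨z, g, hz, hzy, hgz, hlt⟩ := exists_split_of_inf_eq_zero T hTabs huv hy
    (f := f) hf0 (fun _ => rfl) (show 0 < ε / 3 by positivity)
  -- The truncation error is a positive functional of `y`, so its bound at `y` persists at every `q`
  -- in `[0, y]`. The truncated functionals are then enlarged to `evalBidual (b i)` for `i ≠ j` and
  -- to `w` at `j`.
  have bound : ∀ (w : OBidual (E j)), 0 ≤ w → ∀ (d : ∀ i, E i), (∀ i, 0 ≤ d i) →
      (∀ i, d i ≤ b i) → arens ρ A' (Function.update x j w) y ≤
        arens ρ A' (fun i => Function.update x j w i ⊓ evalBidual (d i)) y + ε / 3 →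
      ∀ (q : ODual F) (k : ODual (E j)), 0 ≤ q → q ≤ y → (∀ t, k t = q (T t)) →
      arens ρ A' (Function.update x j w) q ≤ w k + ε / 3 := by
    intro w hw0 d hd hdb hle q k hq hqy hk
    have hinf : ∀ i, 0 ≤ Function.update x j w i ⊓ evalBidual (d i) := fun i =>
      le_inf (hw w hw0 i) (evalBidual_nonneg (hd i))
    have h1 : 0 ≤ arens ρ A' (Function.update x j w) -
        arens ρ A' (fun i => Function.update x j w i ⊓ evalBidual (d i)) :=
      sub_nonneg.2 (arens_mono ρ hpos hinf fun i => inf_le_left)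
    have h2 := ODual.mono h1 hqy
    have h3 : arens ρ A' (fun i => Function.update x j w i ⊓ evalBidual (d i)) q ≤
        arens ρ A' (Function.update (fun i => evalBidual (b i)) j w) q := by
      refine arens_mono ρ hpos hinf (fun i => ?_) q hq
      rcases eq_or_ne i j with rfl | hij
      · simp
      · simpa [hij] using inf_le_right.trans (evalBidual_mono (hdb i))
    rw [arens_update_evalBidual ρ A' b j w q k hk] at h3
    rw [ODual.sub_apply, ODual.sub_apply] at h2
    linarith
  have hu' := bound u hu a ha (fun i => le_sup_left) hau (y - z) (f - g) (sub_nonneg.2 hzy)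
    (sub_le_self y hz) fun t => by
      rw [ODual.sub_apply, ODual.sub_apply, hgz]
      rfl
  have hv' := bound v hv c hc (fun i => le_sup_right) hcv z g hz hzy hgz
  -- The infimum at `y` is at most the sum of the values at `y - z` and `z`: two truncation errors
  -- and `u (f - g) + v g`, each contributing at most `ε / 3`.
  have h := ODual.inf_apply_le (arens ρ A' (Function.update x j u))
    (arens ρ A' (Function.update x j v)) hz hzy
  linarith

end ArensExtension

end RieszArens

theorem proposition3p1 {m : ℕ} {E : Fin m → Type u} {F : Type v}
    [∀ i, AddCommGroup (E i)] [∀ i, Lattice (E i)] [∀ i, IsOrderedAddMonoid (E i)]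
    [∀ i, Module ℝ (E i)] [∀ i, IsOrderedModule ℝ (E i)]
    [AddCommGroup F] [Lattice F] [IsOrderedAddMonoid F] [Module ℝ F] [IsOrderedModule ℝ F]
    (hE : ∀ i, RieszArens.IsArchimedean (E i))
    (A : MultilinearMap ℝ E F) (hA : RieszArens.IsRieszMultimorphism A)
    (ρ : Equiv.Perm (Fin m)) :
    RieszArens.IsRieszMultimorphism
      ((RieszArens.arens ρ ⟨A, hA.mem_regular⟩).compLinearMap
        (fun i => (RieszArens.orderContinuous (RieszArens.ODual (E i))).subtype)) := by
  open RieszArens in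
  have hpos : IsPositive ((arens ρ ⟨A, hA.mem_regular⟩).compLinearMap
      (fun i => (orderContinuous (ODual (E i))).subtype)) :=
    fun x hx => arens_nonneg ρ hA.isPositive hx
  refine ⟨⟨_, 0, hpos, fun _ _ => le_rfl, by simp⟩, hpos.abs_apply_of_disjoint ?_⟩
  intro x hx j u v hu hv huv
  have e : ∀ w : RieszArens.OCDual (RieszArens.ODual (E j)),
      (fun i => ((Function.update x j w i : RieszArens.OCDual (RieszArens.ODual (E i))) :
        RieszArens.OBidual (E i))) = Function.update (fun i => (x i).1) j w.1 := fun w => by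
    funext i
    rcases eq_or_ne i j with rfl | hij
    · simp
    · simp [hij]
  -- Infima in `OCDual` are those of the bidual, so disjointness transfers along `Subtype.val`.
  have h := RieszArens.arens_update_inf_eq_zero ρ hA (x := fun i => (x i).1) hx
    (fun i => (x i).2) j hu hv u.2 v.2 (congrArg Subtype.val huv)
  rw [← e, ← e] at h
  exact h
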